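/- **Conventions.** $I,J,K,L,\dots$ denote finite ordinals; maps between them need not preserve order. Fibres $\varphi^{-1}j$ of a map $\varphi:I\to J$ carry the induced order, and a finite totally ordered set is identified with the isomorphic ordinal. $\bigsqcup_{i\in I}A_i$ denotes concatenation of words. Compositions are written in diagrammatic order. **Symmetric weak multicategories.** A symmetric weak multicategory $\mathbf C$ consists of a class of objects $\mathrm{Ob}\,\mathbf C$; a category $\mathbf C((X_i)_{i\in I};Y)$ for each word $(X_i)_{i\in I}$ and each object $Y$; units $1_X\in\mathbf C(X;X)$; for each map $\varphi:I\to J$ a functor $$\mu_\varphi:\prod_{j\in J}\mathbf C((X_i)_{i\in\varphi^{-1}j};Y_j)\times\mathbf C((Y_j)_{j\in J};Z)\to\mathbf C((X_i)_{i\in I};Z);$$ for each pair of maps $\varphi:I\to J$, $\psi:J\to K$ a natural isomorphism $$\nu_{\varphi,\psi}:\mu_{\varphi\psi}\big((\mu_{\varphi|:\varphi^{-1}\psi^{-1}k\to\psi^{-1}k}((f_j)_{j\in\psi^{-1}k},g_k))_{k\in K},h\big)\to\mu_\varphi\big((f_j)_{j\in J},\mu_\psi((g_k)_{k\in K},h)\big);$$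 and natural isomorphisms $\theta_I:\mu_{\mathrm{id}_I}((1_{X_i})_{i\in I},f)\to f$ and $\zeta_I:\mu_{I\to\mathbf 1}(f,1_Y)\to f$ for $f\in\mathbf C((X_i)_{i\in I};Y)$. They satisfy the pentagon equation for every $I\xrightarrow{\varphi}J\xrightarrow{\psi}K\xrightarrow{\xi}L$, $$\mu_{\varphi\psi\xi}\big((\nu_{\varphi|,\psi|})_{l\in L},1\big)\cdot\nu_{\varphi,\psi\xi}\cdot\mu_\varphi(1,\nu_{\psi,\xi})=\nu_{\varphi\psi,\xi}\cdot\nu_{\varphi,\psi},$$ where $\nu_{\varphi|,\psi|}$ at $l$ is taken for $\varphi^{-1}\psi^{-1}\xi^{-1}l\to\psi^{-1}\xi^{-1}l\to\xi^{-1}l$, and the triangle equation for every $\varphi:I\to J$, $$\nu_{\varphi,\mathrm{id}_J}\cdot\mu_\varphi(1,\theta_J)=\mu_\varphi\big((\zeta_{\varphi^{-1}j})_{j\in J},1\big).$$ **Biprops.** A biprop $\mathcal P$ with set of colours $S$ is a bicategory (composition functors $m$, units $1_A$, associator $a:m(m(F,G),H)\to m(F,m(G,H))$, unitors $l:m(1_A,F)\to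 F$, $r:m(F,1_B)\to F$) whose set of objects is the free monoid $S^*$ of words in $S$, together with functors $$\otimes^{I\xrightarrow{f}L\xleftarrow{g}J}:\prod_{l\in L}\mathcal P\Big(\bigsqcup_{i\in f^{-1}l}A_i;\bigsqcup_{j\in g^{-1}l}B_j\Big)\to\mathcal P\Big(\bigsqcup_{i\in I}A_i;\bigsqcup_{j\in J}B_j\Big)$$ for all maps $f:I\to L\leftarrow J:g$ and all families of words $(A_i)_{i\in I}$, $(B_j)_{j\in J}$, such that 1. (1.1.1) $m(\otimes^{f,g}(F_l)_l,\otimes^{g,h}(G_l)_l)=\otimes^{f,h}(m(F_l,G_l))_l$, as an equality of functors, for all $f:I\to L$, $g:J\to L$, $h:K\to L$; 2. (1.1.2) the associator at $(\otimes^{f,g}(F_n)_n,\otimes^{g,h}(G_n)_n,\otimes^{h,e}(H_n)_n)$ equals $\otimes^{f,e}$ of the family of associators at $(F_n,G_n,H_n)$, $n\in N$, for all $f:I\to N$, $g:J\to N$, $h:K\to N$, $e:L\to N$; 3. (1.1.3) $\otimes^{I\to\mathbf 1\leftarrow J}$ is the identity functor, and $\otimes^{f,f}(1)_{l\in L}=1$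 for every $f:I\to L$; 4. (1.1.4), (1.1.5) the left (right) unitor at $\otimes^{f,g}(F_k)_k$ equals $\otimes^{f,g}$ of the family of left (right) unitors at $F_k$, $k\in K$; 5. (1.1.6) for $f:I\to K$, $g:J\to K$, $h:K\to L$ the functor $\otimes^{f,g}$ equals, up to the identification $\prod_{k\in K}\cong\prod_{l\in L}\prod_{k\in h^{-1}l}$, the functor $\prod_{l\in L}\otimes^{(fh)^{-1}l\to h^{-1}l\leftarrow(gh)^{-1}l}$ followed by $\otimes^{fh,gh}$. **The envelope.** Let $\mathbf C$ be a symmetric weak multicategory. Define $\mathbb F\mathbf C$ as follows. - Its set of colours is $\mathrm{Ob}\,\mathbf C$, its objects are the words in $\mathrm{Ob}\,\mathbf C$, and $$\mathbb F\mathbf C((X_i)_{i\in I};(Y_j)_{j\in J})=\coprod_{\varphi:I\to J}\ \prod_{j\in J}\mathbf C((X_i)_{i\in\varphi^{-1}j};Y_j).$$ - The composition sends the summand indexed by $(\varphi:I\to J,\psi:J\to K)$ to the summand indexed by $\varphi\psi$ by means of $\prod_{k\in K}\mu_{\varphi|:\varphi^{-1}\psi^{-1}k\to\psi^{-1}k}$.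 - The unit of $(X_i)_{i\in I}$ is $(1_{X_i})_{i\in I}$, in the summand indexed by $\mathrm{id}_I$. - On the summand indexed by $I\xrightarrow{\varphi}J\xrightarrow{\psi}K\xrightarrow{\xi}L$ the associator is the product over $l\in L$ of the isomorphisms $\nu$ for $\varphi^{-1}\psi^{-1}\xi^{-1}l\to\psi^{-1}\xi^{-1}l\to\xi^{-1}l$. - On the summand indexed by $\varphi:I\to J$ the left and right unitors are $\prod_{j\in J}\theta_{\varphi^{-1}j}$ and $\prod_{j\in J}\zeta_{\varphi^{-1}j}$. - For $f:I\to K$, $g:J\to K$ and words $A_i$, $B_j$ with sets of positions $S_i$, $Q_j$, the functor $\otimes^{I\xrightarrow{f}K\xleftarrow{g}J}$ identically maps the summand indexed by a family $\big(\varphi_k:\bigsqcup_{i\in f^{-1}k}S_i\to\bigsqcup_{j\in g^{-1}k}Q_j\big)_{k\in K}$ to the summand indexed by the unique map $\varphi:\bigsqcup_{i\in I}S_i\to\bigsqcup_{j\in J}Q_j$ over $K$ which restricts to $\varphi_k$ for each $k\in K$. **Theorem.** For every symmetric weak multicategory $\mathbf C$, the data $\mathbb F\mathbf C$ is a biprop: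 it is a bicategory and satisfies (1.1.1)–(1.1.6). -/

import Mathlib

open CategoryTheory

universe w v u

set_option linter.checkUnivs false

namespace BipropEnvelope

section Indices

variable {n m p : ℕ}

/-- The fibre `f⁻¹ j`, as a finite subset of the domain. -/
def fib (f : Fin n → Fin m) (j : Fin m) : Finset (Fin n) := Finset.univ.filter (fun i => f i = j)

theorem mem_fib (f : Fin n → Fin m) (j : Fin m) (i : Fin n) : i ∈ fib f j ↔ f i = j := by
  simp [fib]

/-- The cardinality of the fibre `f⁻¹ j`. -/
def fibCard (f : Fin n → Fin m) (j : Fin m) : ℕ := (fib f j).card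

/-- The increasing enumeration of the fibre `f⁻¹ j`. -/
def fibEmb (f : Fin n → Fin m) (j : Fin m) : Fin (fibCard f j) ↪o Fin n :=
  (fib f j).orderEmbOfFin rfl

theorem apply_fibEmb (f : Fin n → Fin m) (j : Fin m) (i : Fin (fibCard f j)) :
    f (fibEmb f j i) = j :=
  (mem_fib f j _).1 ((fib f j).orderEmbOfFin_mem rfl i)

theorem range_fibEmb (f : Fin n → Fin m) (j : Fin m) :
    Set.range (fibEmb f j) = {i | f i = j} := by
  refine ((fib f j).range_orderEmbOfFin rfl).trans ?_
  ext i
  simp [mem_fib]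

/-- The position in the fibre `f⁻¹ j` of an element `i` with `f i = j`. -/
def fibIdx (f : Fin n → Fin m) (j : Fin m) (i : Fin n) (h : f i = j) : Fin (fibCard f j) :=
  ((fib f j).orderIsoOfFin rfl).symm ⟨i, (mem_fib f j i).2 h⟩

theorem fibEmb_fibIdx (f : Fin n → Fin m) (j : Fin m) (i : Fin n) (h : f i = j) :
    fibEmb f j (fibIdx f j i h) = i := by
  have := congrArg Subtype.val
    (((fib f j).orderIsoOfFin rfl).apply_symm_apply ⟨i, (mem_fib f j i).2 h⟩)
  exact this

/-- The restriction `f|_k : (f g)⁻¹ k → g⁻¹ k` of `f : I → J` to the fibres over an element `k` of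
the target of `g : J → K`. -/
def fibRestr (f : Fin n → Fin m) (g : Fin m → Fin p) (k : Fin p) :
    Fin (fibCard (g ∘ f) k) → Fin (fibCard g k) :=
  fun i => fibIdx g k (f (fibEmb (g ∘ f) k i)) (apply_fibEmb (g ∘ f) k i)

theorem fibEmb_fibRestr (f : Fin n → Fin m) (g : Fin m → Fin p) (k : Fin p)
    (i : Fin (fibCard (g ∘ f) k)) :
    fibEmb g k (fibRestr f g k i) = f (fibEmb (g ∘ f) k i) :=
  fibEmb_fibIdx _ _ _ _

/-- Increasing enumerations of the same subset coincide. -/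
theorem enum_unique {a b : ℕ} {e : Fin a → Fin n} {e' : Fin b → Fin n} (he : StrictMono e)
    (he' : StrictMono e') (h : Set.range e = Set.range e') :
    a = b ∧ ∀ (i : Fin a) (i' : Fin b), i.val = i'.val → e i = e' i' := by
  have hab : a = b := by
    have h1 := Set.card_range_of_injective he.injective
    have h2 := Set.card_range_of_injective he'.injective
    simp only [Fintype.card_fin] at h1 h2
    rw [← h1, ← h2]
    simp only [h]
  subst hab
  refine ⟨rfl, fun i i' hi => ?_⟩
  rw [(he.range_inj he').1 h, Fin.ext hi]

theorem enum_fib {a : ℕ} {f : Fin n → Fin m} {j : Fin m} {e : Fin a → Fin n} (he : StrictMono e)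
    (h : ∀ i, i ∈ Set.range e ↔ f i = j) :
    a = fibCard f j ∧ ∀ (i : Fin a) (i' : Fin (fibCard f j)), i.val = i'.val →
      e i = fibEmb f j i' :=
  enum_unique he (fibEmb f j).strictMono (by rw [range_fibEmb]; exact Set.ext h)

/-- The fibre of a restricted map is the fibre of the map itself. -/
theorem fib_fibRestr (f : Fin n → Fin m) (g : Fin m → Fin p) (k : Fin p) (j : Fin (fibCard g k)) :
    fibCard (fibRestr f g k) j = fibCard f (fibEmb g k j) ∧
    ∀ (i : Fin (fibCard (fibRestr f g k) j)) (i' : Fin (fibCard f (fibEmb g k j))),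
      i.val = i'.val →
      fibEmb (g ∘ f) k (fibEmb (fibRestr f g k) j i) = fibEmb f (fibEmb g k j) i' := by
  refine enum_fib (e := fun i => fibEmb (g ∘ f) k (fibEmb (fibRestr f g k) j i))
    (fun x y h => (fibEmb (g ∘ f) k).strictMono ((fibEmb (fibRestr f g k) j).strictMono h)) ?_
  intro i
  constructor
  · rintro ⟨x, rfl⟩
    exact (fibEmb_fibRestr f g k _).symm.trans (congrArg _ (apply_fibEmb _ _ _))
  · intro h
    have h1 : (g ∘ f) i = k := by simp [h, apply_fibEmb]
    refine ⟨fibIdx _ _ (fibIdx (g ∘ f) k i h1) ?_, ?_⟩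
    · apply (fibEmb g k).injective
      rw [fibEmb_fibRestr, fibEmb_fibIdx, h]
    · simp only [fibEmb_fibIdx]

theorem fibRestr_id (f : Fin n → Fin m) (j : Fin m) : fibRestr id f j = id := by
  funext i
  apply (fibEmb f j).injective
  exact fibEmb_fibRestr id f j i

theorem fibEmb_congr {f f' : Fin n → Fin m} (h : f = f') {j : Fin m}
    {i : Fin (fibCard f j)} {i' : Fin (fibCard f' j)} (hi : i.val = i'.val) :
    fibEmb f j i = fibEmb f' j i' := by
  subst h
  rw [Fin.ext hi]

variable {r : ℕ} (φ : Fin n → Fin m) (ψ : Fin m → Fin p) (ξ : Fin p → Fin r) (l : Fin r)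

theorem fibRestr_comp : fibRestr ψ ξ l ∘ fibRestr φ (ξ ∘ ψ) l = fibRestr (ψ ∘ φ) ξ l := by
  funext i
  apply (fibEmb ξ l).injective
  refine (fibEmb_fibRestr ψ ξ l _).trans ?_
  rw [fibEmb_fibRestr]
  exact (fibEmb_fibRestr (ψ ∘ φ) ξ l i).symm

theorem fibRestr_val (k : Fin (fibCard ξ l))
    (i : Fin (fibCard (fibRestr ψ ξ l ∘ fibRestr φ (ξ ∘ ψ) l) k))
    (i' : Fin (fibCard (ψ ∘ φ) (fibEmb ξ l k))) (hi : i.val = i'.val) :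
    (fibRestr (fibRestr φ (ξ ∘ ψ) l) (fibRestr ψ ξ l) k i).val =
      (fibRestr φ ψ (fibEmb ξ l k) i').val := by
  obtain ⟨h1, h2⟩ := fib_fibRestr ψ ξ l k
  set x := fibRestr (fibRestr φ (ξ ∘ ψ) l) (fibRestr ψ ξ l) k i with hx
  have h3 := h2 x (Fin.cast h1 x) rfl
  suffices Fin.cast h1 x = fibRestr φ ψ (fibEmb ξ l k) i' from congrArg Fin.val this
  apply (fibEmb ψ (fibEmb ξ l k)).injective
  have hc := fibRestr_comp φ ψ ξ l
  obtain ⟨h4, h5⟩ := fib_fibRestr (ψ ∘ φ) ξ l k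
  have hcard : fibCard (fibRestr ψ ξ l ∘ fibRestr φ (ξ ∘ ψ) l) k =
    fibCard (fibRestr (ψ ∘ φ) ξ l) k := by rw [hc]
  calc _ = fibEmb (ξ ∘ ψ) l (fibEmb (fibRestr ψ ξ l) k x) := h3.symm
    _ = fibEmb (ξ ∘ ψ) l (fibRestr φ (ξ ∘ ψ) l
          (fibEmb (fibRestr ψ ξ l ∘ fibRestr φ (ξ ∘ ψ) l) k i)) := by
        rw [hx, fibEmb_fibRestr]
    _ = φ (fibEmb ((ξ ∘ ψ) ∘ φ) l (fibEmb (fibRestr ψ ξ l ∘ fibRestr φ (ξ ∘ ψ) l) k i)) :=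
        fibEmb_fibRestr _ _ _ _
    _ = φ (fibEmb (ψ ∘ φ) (fibEmb ξ l k) i') := by
        refine congrArg φ (Eq.trans ?_ (h5 (Fin.cast hcard i) i' hi))
        exact congrArg (fibEmb ((ξ ∘ ψ) ∘ φ) l) (fibEmb_congr hc rfl)
    _ = _ := (fibEmb_fibRestr _ _ _ _).symm

end Indices

/-- A word in the alphabet `S`: a tuple `(X_i)_{i ∈ I}` of elements of `S`, indexed by a finite
ordinal `I`. -/
@[ext]
structure Word (S : Type u) where
  /-- the length of the word -/
  len : ℕ
  /-- the letters -/
  col : Fin len → S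

namespace Word

variable {S : Type u}

theorem eq_of {A B : Word S} (h : A.len = B.len)
    (h' : ∀ (i : Fin A.len) (i' : Fin B.len), i.val = i'.val → A.col i = B.col i') : A = B := by
  obtain ⟨a, A⟩ := A
  obtain ⟨b, B⟩ := B
  dsimp only at h
  subst h
  congr 1
  funext i
  exact h' i i rfl

/-- The one-letter word. -/
abbrev single (X : S) : Word S := ⟨1, fun _ => X⟩

/-- The word `(X_i)_{i ∈ f⁻¹ j}`. -/
abbrev fibre (A : Word S) {m : ℕ} (f : Fin A.len → Fin m) (j : Fin m) : Word S :=
  ⟨fibCard f j, fun i => A.col (fibEmb f j i)⟩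

theorem eq_fibre {A w : Word S} {m : ℕ} {f : Fin A.len → Fin m} {j : Fin m}
    (e : Fin w.len → Fin A.len) (he : StrictMono e) (h : ∀ i, i ∈ Set.range e ↔ f i = j)
    (hc : ∀ i, w.col i = A.col (e i)) : w = A.fibre f j := by
  obtain ⟨h1, h2⟩ := enum_fib he h
  exact eq_of h1 fun i i' hi => by rw [hc, h2 i i' hi]

theorem fibre_fibRestr (A : Word S) {m p : ℕ} (f : Fin A.len → Fin m) (g : Fin m → Fin p)
    (k : Fin p) (j : Fin (fibCard g k)) :
    (A.fibre (g ∘ f) k).fibre (fibRestr f g k) j = A.fibre f (fibEmb g k j) :=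
  eq_of (fib_fibRestr f g k j).1 fun i i' hi => by
    simp only [fibre]
    rw [← (fib_fibRestr f g k j).2 i i' hi]

theorem fibre_comp_restr (A : Word S) {m p r : ℕ} (φ : Fin A.len → Fin m) (ψ : Fin m → Fin p)
    (ξ : Fin p → Fin r) (l : Fin r) (k : Fin (fibCard ξ l)) :
    (A.fibre (ξ ∘ ψ ∘ φ) l).fibre (fibRestr ψ ξ l ∘ fibRestr φ (ξ ∘ ψ) l) k =
      A.fibre (ψ ∘ φ) (fibEmb ξ l k) := by
  rw [fibRestr_comp]
  exact A.fibre_fibRestr (ψ ∘ φ) ξ l k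

theorem single_eq_fibre_id (A : Word S) (i : Fin A.len) : single (A.col i) = A.fibre id i :=
  eq_fibre (fun _ => i) (fun x y h => absurd h (by
    rw [Subsingleton.elim (α := Fin 1) x y]; exact lt_irrefl _))
    (fun x => by simp [eq_comm]) (fun _ => rfl)

theorem eq_fibre_const (A : Word S) (j : Fin 1) : A = A.fibre (fun _ => (0 : Fin 1)) j :=
  eq_fibre id strictMono_id (fun x => by simp [Subsingleton.elim j 0]) (fun _ => rfl)

/-- The concatenation `⊔_{i ∈ I} A_i`; its set of positions is the lexicographically ordered
disjoint union of the sets of positions of the words `A_i`. -/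
def concat {n : ℕ} (A : Fin n → Word S) : Word S :=
  ⟨∑ i, (A i).len, fun s => (A (finSigmaFinEquiv.symm s).1).col (finSigmaFinEquiv.symm s).2⟩

/-- The projection `pr_I` of the positions of `⊔_{i ∈ I} A_i` to `I`. -/
def pr {n : ℕ} (A : Fin n → Word S) (s : Fin (concat A).len) : Fin n := (finSigmaFinEquiv.symm s).1

/-- The position of `pr s`-th word at which `s` lies. -/
def pos {n : ℕ} (A : Fin n → Word S) (s : Fin (concat A).len) : Fin (A (pr A s)).len :=
  (finSigmaFinEquiv.symm s).2

/-- The position of `⊔_{i ∈ I} A_i` given by a position of `A_i`. -/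
def inj {n : ℕ} (A : Fin n → Word S) (i : Fin n) (s : Fin (A i).len) : Fin (concat A).len :=
  finSigmaFinEquiv ⟨i, s⟩

@[simp] theorem pr_inj {n : ℕ} (A : Fin n → Word S) (i : Fin n) (s : Fin (A i).len) :
    pr A (inj A i s) = i := by
  simp [pr, inj]

theorem inj_pr_pos {n : ℕ} (A : Fin n → Word S) (s : Fin (concat A).len) :
    inj A (pr A s) (pos A s) = s :=
  finSigmaFinEquiv.apply_symm_apply s

theorem pos_inj {n : ℕ} (A : Fin n → Word S) (i : Fin n) (s : Fin (A i).len) :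
    (pos A (inj A i s)).val = s.val := by
  have h : ∀ x y : (i : Fin n) × Fin (A i).len, x = y → x.2.val = y.2.val := by
    rintro x _ rfl; rfl
  exact h _ _ (finSigmaFinEquiv.symm_apply_apply ⟨i, s⟩)

theorem inj_congr {n : ℕ} (A : Fin n → Word S) {i i' : Fin n} {s : Fin (A i).len}
    {s' : Fin (A i').len} (h : i = i') (hs : s.val = s'.val) : inj A i s = inj A i' s' := by
  subst h
  rw [Fin.ext hs]

theorem concat_col {n : ℕ} (A : Fin n → Word S) (s : Fin (concat A).len) :
    (concat A).col s = (A (pr A s)).col (pos A s) := rfl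

theorem concat_col_inj {n : ℕ} (A : Fin n → Word S) (i : Fin n) (s : Fin (A i).len) :
    (concat A).col (inj A i s) = (A i).col s := by
  have h : ∀ x y : (i : Fin n) × Fin (A i).len, x = y → (A x.1).col x.2 = (A y.1).col y.2 := by
    rintro x _ rfl; rfl
  exact h _ _ (finSigmaFinEquiv.symm_apply_apply ⟨i, s⟩)

theorem inj_lt {n : ℕ} (A : Fin n → Word S) {i i' : Fin n} (s : Fin (A i).len)
    (s' : Fin (A i').len) (h : i < i' ∨ (i = i' ∧ s.val < s'.val)) :
    inj A i s < inj A i' s' := by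
  rw [Fin.lt_def]
  unfold inj
  rw [finSigmaFinEquiv_apply, finSigmaFinEquiv_apply]
  rcases h with h | ⟨rfl, h⟩
  · let N : ℕ → ℕ := fun t => if ht : t < n then (A ⟨t, ht⟩).len else 0
    have key : ∀ j : Fin n, ∑ t : Fin j.val, (A (Fin.castLE j.2.le t)).len
        = ∑ t ∈ Finset.range j.val, N t := by
      intro j
      rw [Finset.sum_range]
      refine Finset.sum_congr rfl fun t _ => ?_
      simp only [N, dif_pos (t.2.trans j.2)]
      rfl
    have h1 : ∑ t ∈ Finset.range (i.val + 1), N t ≤ ∑ t ∈ Finset.range i'.val, N t :=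
      Finset.sum_le_sum_of_subset (Finset.range_mono h)
    rw [Finset.sum_range_succ] at h1
    have h2 : N i.val = (A i).len := by simp [N]
    have h3 := s.2
    simp only [key]
    omega
  · simpa using h

theorem inj_strictMono_iff {n : ℕ} (A : Fin n → Word S) {s s' : Fin (concat A).len} (h : s < s') :
    pr A s < pr A s' ∨ (pr A s = pr A s' ∧ (pos A s).val < (pos A s').val) := by
  by_contra hc
  have h1 : s' ≤ s := by
    rw [← inj_pr_pos A s, ← inj_pr_pos A s']
    rcases lt_trichotomy (pr A s) (pr A s') with h2 | h2 | h2
    · exact absurd (Or.inl h2) hc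
    · rcases lt_trichotomy (pos A s).val (pos A s').val with h3 | h3 | h3
      · exact absurd (Or.inr ⟨h2, h3⟩) hc
      · exact (inj_congr A h2 h3).ge
      · exact (inj_lt A _ _ (Or.inr ⟨h2.symm, h3⟩)).le
    · exact (inj_lt A _ _ (Or.inl h2)).le
  exact absurd h (not_lt.2 h1)

/-- The word `⊔_{i ∈ f⁻¹ l} A_i`. -/
abbrev concatFib {n m : ℕ} (A : Fin n → Word S) (f : Fin n → Fin m) (l : Fin m) : Word S :=
  concat fun i => A (fibEmb f l i)

section Blocks

variable {n m : ℕ} (A : Fin n → Word S) (f : Fin n → Fin m)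

/-- The map `pr_I · f` from the positions of `⊔_{i ∈ I} A_i` to the target of `f`. -/
abbrev blk (s : Fin (concat A).len) : Fin m := f (pr A s)

/-- The inclusion of the positions of `⊔_{i ∈ f⁻¹ l} A_i` into those of `⊔_{i ∈ I} A_i`. -/
def blkEmb (l : Fin m) (s : Fin (concatFib A f l).len) : Fin (concat A).len :=
  inj A (fibEmb f l (pr _ s)) (pos (fun i => A (fibEmb f l i)) s)

/-- The position in `⊔_{i ∈ f⁻¹ l} A_i` of a position `s` of `⊔_{i ∈ I} A_i` lying over `l`. -/
def blkIdx (l : Fin m) (s : Fin (concat A).len) (h : blk A f s = l) :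
    Fin (concatFib A f l).len :=
  inj (fun i => A (fibEmb f l i)) (fibIdx f l (pr A s) h)
    (Fin.cast (congrArg (fun i => (A i).len) (fibEmb_fibIdx f l (pr A s) h).symm) (pos A s))

theorem blk_blkEmb (l : Fin m) (s : Fin (concatFib A f l).len) :
    blk A f (blkEmb A f l s) = l := by
  simp [blk, blkEmb, apply_fibEmb]

theorem blkEmb_blkIdx (l : Fin m) (s : Fin (concat A).len) (h : blk A f s = l) :
    blkEmb A f l (blkIdx A f l s h) = s := by
  refine Eq.trans ?_ (inj_pr_pos A s)
  refine inj_congr A ?_ ?_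
  · rw [blkIdx, pr_inj]
    exact fibEmb_fibIdx f l _ h
  · rw [blkIdx, pos_inj]
    rfl

theorem blkEmb_strictMono (l : Fin m) : StrictMono (blkEmb A f l) := by
  intro s s' h
  refine inj_lt A _ _ ?_
  rcases inj_strictMono_iff _ h with h | ⟨h, h'⟩
  · exact Or.inl ((fibEmb f l).strictMono h)
  · exact Or.inr ⟨congrArg _ h, h'⟩

theorem concatFib_col (l : Fin m) (s : Fin (concatFib A f l).len) :
    (concatFib A f l).col s = (concat A).col (blkEmb A f l s) :=
  (concat_col_inj A (fibEmb f l (pr _ s)) (pos (fun i => A (fibEmb f l i)) s)).symm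

end Blocks

theorem concat_congr {n n' : ℕ} {A : Fin n → Word S} {A' : Fin n' → Word S} (h : n = n')
    (h' : ∀ (i : Fin n) (i' : Fin n'), i.val = i'.val → A i = A' i') : concat A = concat A' := by
  subst h
  congr 1
  funext i
  exact h' i i rfl

theorem concatFib_const {n : ℕ} (A : Fin n → Word S) (j : Fin 1) :
    concat A = concatFib A (fun _ => (0 : Fin 1)) j := by
  obtain ⟨h1, h2⟩ := enum_fib (f := fun _ : Fin n => (0 : Fin 1)) (j := j) (e := id)
    strictMono_id (fun x => by simp [Subsingleton.elim j 0])
  exact concat_congr h1 fun i i' hi => congrArg A (h2 i i' hi)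

theorem concatFib_fibRestr {n m p : ℕ} (A : Fin n → Word S) (f : Fin n → Fin m)
    (g : Fin m → Fin p) (k : Fin p) (j : Fin (fibCard g k)) :
    concatFib A f (fibEmb g k j) =
      concatFib (fun i => A (fibEmb (g ∘ f) k i)) (fibRestr f g k) j :=
  (concat_congr (fib_fibRestr f g k j).1 fun i i' hi =>
    congrArg A ((fib_fibRestr f g k j).2 i i' hi)).symm

section Glue

variable {I J K : ℕ} (f : Fin I → Fin K) (g : Fin J → Fin K) (A : Fin I → Word S)
  (B : Fin J → Word S)
  (φ : ∀ k, Fin (concatFib A f k).len → Fin (concatFib B g k).len)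

/-- The unique map `φ : ⊔_{i ∈ I} S_i → ⊔_{j ∈ J} Q_j` over `K` which restricts to the given maps
`φ_k : ⊔_{i ∈ f⁻¹ k} S_i → ⊔_{j ∈ g⁻¹ k} Q_j`. -/
def glue (s : Fin (concat A).len) : Fin (concat B).len :=
  blkEmb B g (blk A f s) (φ (blk A f s) (blkIdx A f (blk A f s) s rfl))

theorem glue_blkEmb (k : Fin K) (s : Fin (concatFib A f k).len) :
    glue f g A B φ (blkEmb A f k s) = blkEmb B g k (φ k s) := by
  have key : ∀ (t : Fin (concat A).len) (k : Fin K) (ht : blk A f t = k),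
      glue f g A B φ t = blkEmb B g k (φ k (blkIdx A f k t ht)) := by
    rintro t _ rfl
    rfl
  rw [key _ k (blk_blkEmb A f k s)]
  congr 2
  exact (blkEmb_strictMono A f k).injective (blkEmb_blkIdx A f k _ _)

theorem blk_glue (s : Fin (concat A).len) : blk B g (glue f g A B φ s) = blk A f s :=
  blk_blkEmb _ _ _ _

theorem fibre_glue (k : Fin K) (q : Fin (concatFib B g k).len) :
    (concatFib A f k).fibre (φ k) q = (concat A).fibre (glue f g A B φ) (blkEmb B g k q) := by
  refine eq_fibre (fun s => blkEmb A f k (fibEmb (φ k) q s))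
    (fun x y h => blkEmb_strictMono A f k ((fibEmb (φ k) q).strictMono h)) (fun i => ?_)
    (fun s => concatFib_col A f k _)
  constructor
  · rintro ⟨s, rfl⟩
    exact (glue_blkEmb f g A B φ k _).trans (congrArg _ (apply_fibEmb _ _ _))
  · intro h
    have hk : blk A f i = k := by rw [← blk_glue f g A B φ i, h, blk_blkEmb]
    rw [← blkEmb_blkIdx A f k i hk, glue_blkEmb] at h
    exact ⟨fibIdx _ _ _ ((blkEmb_strictMono B g k).injective h), by
      simp only [fibEmb_fibIdx, blkEmb_blkIdx]⟩

theorem fibre_glue_blkIdx (q : Fin (concat B).len) :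
    (concatFib A f (blk B g q)).fibre (φ (blk B g q)) (blkIdx B g (blk B g q) q rfl) =
      (concat A).fibre (glue f g A B φ) q := by
  rw [fibre_glue, blkEmb_blkIdx]

theorem col_blkIdx (q : Fin (concat B).len) :
    (concatFib B g (blk B g q)).col (blkIdx B g (blk B g q) q rfl) = (concat B).col q := by
  rw [concatFib_col, blkEmb_blkIdx]

end Glue

end Word

/-- The categories, units and composition functors of a symmetric weak multicategory. -/
structure MulticatData where
  /-- the objects -/
  Ob : Type u
  /-- the category `C((X_i)_{i ∈ I}; Y)` -/
  Hom : Word Ob → Ob → Type v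
  [cat : ∀ A Y, Category.{w} (Hom A Y)]
  /-- the units `1_X ∈ C(X; X)` -/
  one : ∀ X, Hom (Word.single X) X
  /-- For every map `φ : I → J` the composition functor
  `μ_φ : ∏_{j ∈ J} C((X_i)_{i ∈ φ⁻¹ j}; Y_j) × C((Y_j)_{j ∈ J}; Z) ⥤ C((X_i)_{i ∈ I}; Z)`.
  The word `U j` equals `(X_i)_{i ∈ φ⁻¹ j}`; it is a variable only in order to apply `μ_φ` to
  words which are equal to `(X_i)_{i ∈ φ⁻¹ j}` but are presented differently. -/
  μ {A B : Word Ob} {Z : Ob} (φ : Fin A.len → Fin B.len) (U : Fin B.len → Word Ob)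
    (hU : ∀ j, U j = A.fibre φ j) : (∀ j, Hom (U j) (B.col j)) × Hom B Z ⥤ Hom A Z

namespace MulticatData

attribute [instance] MulticatData.cat

variable (C : MulticatData.{w, v, u})

/-- The identity functor, for equal words and equal letters. -/
def castFunctor {A A' : Word C.Ob} {Y Y' : C.Ob} (hA : A = A') (hY : Y = Y') :
    C.Hom A Y ⥤ C.Hom A' Y' :=
  match A', Y', hA, hY with
  | _, _, rfl, rfl => 𝟭 _

/-- An object of `C(A; Y)`, viewed as an object of `C(A'; Y)` when `A = A'`. -/
def castObj {A A' : Word C.Ob} {Y : C.Ob} (hA : A = A') (x : C.Hom A Y) : C.Hom A' Y :=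
  (C.castFunctor hA rfl).obj x

theorem castObj_heq {A A' : Word C.Ob} {Y : C.Ob} (hA : A = A') (x : C.Hom A Y) :
    HEq (C.castObj hA x) x := by
  subst hA; rfl

/-- The functor `μ_φ`. -/
abbrev comp {A B : Word C.Ob} {Z : C.Ob} (φ : Fin A.len → Fin B.len) :
    (∀ j, C.Hom (A.fibre φ j) (B.col j)) × C.Hom B Z ⥤ C.Hom A Z :=
  C.μ φ (A.fibre φ) (fun _ => rfl)

/-- The family of units `(1_{X_i})_{i ∈ I} ∈ ∏_{i ∈ I} C((X_{i'})_{i' ∈ id⁻¹ i}; X_i)`. -/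
def ones (A : Word C.Ob) (i : Fin A.len) : C.Hom (A.fibre id i) (A.col i) :=
  C.castObj (A.single_eq_fibre_id i) (C.one (A.col i))

/-- For maps `φ : I → J`, `ψ : J → K` and `k ∈ K`, the composition functor
`μ_{φ| : φ⁻¹ ψ⁻¹ k → ψ⁻¹ k}` of the restricted map, preceded by the projection of the product over
`J` to the product over `ψ⁻¹ k`. -/
def compAt {A B : Word C.Ob} {p : ℕ} {Z : C.Ob} (φ : Fin A.len → Fin B.len)
    (ψ : Fin B.len → Fin p) (k : Fin p) :
    (∀ j, C.Hom (A.fibre φ j) (B.col j)) × C.Hom (B.fibre ψ k) Z ⥤ C.Hom (A.fibre (ψ ∘ φ) k) Z :=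
  Functor.prod (Functor.pi' fun j => Pi.eval _ (fibEmb ψ k j)) (𝟭 _) ⋙
    C.μ (A := A.fibre (ψ ∘ φ) k) (B := B.fibre ψ k) (fibRestr φ ψ k)
      (fun j => A.fibre φ (fibEmb ψ k j)) (fun j => (A.fibre_fibRestr φ ψ k j).symm)

/-- `μ` respects equality of its arguments. -/
theorem μ_obj_heq {A A' B B' : Word C.Ob} {Z : C.Ob} {φ : Fin A.len → Fin B.len}
    {φ' : Fin A'.len → Fin B'.len} {U : Fin B.len → Word C.Ob} {U' : Fin B'.len → Word C.Ob}
    {hU : ∀ j, U j = A.fibre φ j} {hU' : ∀ j, U' j = A'.fibre φ' j}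
    {f : ∀ j, C.Hom (U j) (B.col j)} {f' : ∀ j, C.Hom (U' j) (B'.col j)}
    {g : C.Hom B Z} {g' : C.Hom B' Z}
    (hA : A = A') (hB : B = B')
    (hφ : ∀ i i', i.val = i'.val → (φ i).val = (φ' i').val)
    (hf : ∀ j j', j.val = j'.val → HEq (f j) (f' j')) (hg : HEq g g') :
    HEq ((C.μ φ U hU).obj (f, g)) ((C.μ φ' U' hU').obj (f', g')) := by
  subst hA hB
  obtain rfl : φ = φ' := funext fun i => Fin.ext (hφ i i rfl)
  obtain rfl : U = U' := funext fun j => (hU j).trans (hU' j).symm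
  obtain rfl : f = f' := funext fun j => eq_of_heq (hf j j rfl)
  rw [eq_of_heq hg]

section

variable {A B D : Word C.Ob} {p : ℕ} (φ : Fin A.len → Fin B.len) (ψ : Fin B.len → Fin D.len)
  (ξ : Fin D.len → Fin p) (l : Fin p)

/-- The subfamily of `(f_j)_{j ∈ J}`, `f_j ∈ C((X_i)_{i ∈ φ⁻¹ j}; Y_j)`, indexed by `ψ⁻¹ k`. -/
def restrict {q : ℕ} (ψ : Fin B.len → Fin q) (k : Fin q)
    (f : ∀ j, C.Hom (A.fibre φ j) (B.col j)) (j : Fin (B.fibre ψ k).len) :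
    C.Hom ((A.fibre (ψ ∘ φ) k).fibre (fibRestr φ ψ k) j) ((B.fibre ψ k).col j) :=
  C.castObj (A.fibre_fibRestr φ ψ k j).symm (f (fibEmb ψ k j))

theorem restrict_heq (k : Fin (fibCard ξ l)) (f : ∀ j, C.Hom (A.fibre φ j) (B.col j))
    (j : Fin (fibCard (fibRestr ψ ξ l) k)) (j' : Fin (fibCard ψ (fibEmb ξ l k)))
    (hj : j.val = j'.val) :
    HEq (C.castObj ((A.fibre_fibRestr φ (ξ ∘ ψ) l (fibEmb (fibRestr ψ ξ l) k j)).symm)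
      (f (fibEmb (ξ ∘ ψ) l (fibEmb (fibRestr ψ ξ l) k j))))
      (f (fibEmb ψ (fibEmb ξ l k) j')) := by
  refine (C.castObj_heq _ _).trans ?_
  rw [(fib_fibRestr ψ ξ l k).2 j j' hj]

/-- The source of `ν` for the restrictions of `φ` and `ψ` to the fibres over `l`. -/
theorem comp_compAt_restrict {Z : C.Ob} (f : ∀ j, C.Hom (A.fibre φ j) (B.col j))
    (g : ∀ k, C.Hom (B.fibre ψ k) (D.col k)) (h : C.Hom (D.fibre ξ l) Z) :
    (C.compAt (ψ ∘ φ) ξ l).obj (fun k => (C.compAt φ ψ k).obj (f, g k), h) =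
    (C.comp (A := A.fibre (ξ ∘ ψ ∘ φ) l) (B := D.fibre ξ l)
      (fibRestr ψ ξ l ∘ fibRestr φ (ξ ∘ ψ) l)).obj
      (fun k => (C.compAt (A := A.fibre (ξ ∘ ψ ∘ φ) l) (B := B.fibre (ξ ∘ ψ) l)
        (fibRestr φ (ξ ∘ ψ) l) (fibRestr ψ ξ l) k).obj
          (C.restrict φ (ξ ∘ ψ) l f, C.restrict ψ ξ l g k), h) := by
  refine (eq_of_heq (C.μ_obj_heq rfl rfl ?_ ?_ HEq.rfl)).symm
  · intro i i' hi
    obtain rfl := Fin.ext hi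
    rw [fibRestr_comp]
  · intro k k' hk
    obtain rfl := Fin.ext hk
    refine C.μ_obj_heq (A.fibre_comp_restr φ ψ ξ l k) (B.fibre_fibRestr ψ ξ l k) ?_ ?_
      (C.castObj_heq _ _)
    · exact fun i i' hi => fibRestr_val φ ψ ξ l k i i' hi
    · exact fun j j' hj => C.restrict_heq φ ψ ξ l k f j j' hj

/-- The target of `ν` for the restrictions of `φ` and `ψ` to the fibres over `l`. -/
theorem comp_comp_restrict {Z : C.Ob} (f : ∀ j, C.Hom (A.fibre φ j) (B.col j))
    (g : ∀ k, C.Hom (B.fibre ψ k) (D.col k)) (h : C.Hom (D.fibre ξ l) Z) :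
    (C.comp (A := A.fibre (ξ ∘ ψ ∘ φ) l) (B := B.fibre (ξ ∘ ψ) l) (fibRestr φ (ξ ∘ ψ) l)).obj
      (C.restrict φ (ξ ∘ ψ) l f, (C.comp (A := B.fibre (ξ ∘ ψ) l) (B := D.fibre ξ l)
        (fibRestr ψ ξ l)).obj (C.restrict ψ ξ l g, h)) =
    (C.compAt φ (ξ ∘ ψ) l).obj (f, (C.compAt ψ ξ l).obj (g, h)) := by
  refine eq_of_heq (C.μ_obj_heq rfl rfl ?_ ?_ (C.μ_obj_heq rfl rfl ?_ ?_ HEq.rfl))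
  · intro i i' hi; obtain rfl := Fin.ext hi; rfl
  · intro k k' hk; obtain rfl := Fin.ext hk; exact C.castObj_heq _ _
  · intro i i' hi; obtain rfl := Fin.ext hi; rfl
  · intro k k' hk; obtain rfl := Fin.ext hk; exact C.castObj_heq _ _

end

section

variable {A B : Word C.Ob}

theorem ones_heq (i : Fin A.len) : HEq (C.ones A i) (C.one (A.col i)) := C.castObj_heq _ _

theorem compAt_ones {p : ℕ} {Z : C.Ob} (φ : Fin A.len → Fin p) (j : Fin p)
    (f : C.Hom (A.fibre φ j) Z) :
    (C.compAt id φ j).obj (C.ones A, f) =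
      (C.comp (A := A.fibre φ j) (B := A.fibre φ j) id).obj (C.ones (A.fibre φ j), f) := by
  refine eq_of_heq (C.μ_obj_heq rfl rfl ?_ ?_ HEq.rfl)
  · intro i i' hi
    obtain rfl := Fin.ext hi
    rw [fibRestr_id]
  · intro i i' hi
    obtain rfl := Fin.ext hi
    exact (C.ones_heq _).trans (C.ones_heq (A := A.fibre φ j) i).symm

theorem compAt_id_ones (φ : Fin A.len → Fin B.len) (f : ∀ j, C.Hom (A.fibre φ j) (B.col j))
    (j : Fin B.len) :
    (C.compAt φ id j).obj (f, C.ones B j) =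
      (C.μ (A := A.fibre φ j) (B := Word.single (B.col j)) (fun _ => (0 : Fin 1))
        (fun _ => A.fibre φ j) (A.fibre φ j).eq_fibre_const).obj
        (fun _ => f j, C.one (B.col j)) := by
  have h1 := B.single_eq_fibre_id j
  refine eq_of_heq (C.μ_obj_heq rfl h1.symm ?_ ?_ (C.ones_heq j))
  · intro i i' _
    have h2 : fibCard id j = 1 := congrArg Word.len h1.symm
    have h3 := (fibRestr φ id j i).2
    change (fibRestr φ id j i).val = 0
    omega
  · intro i i' _
    have h2 : fibEmb id j i = j := apply_fibEmb id j i
    change HEq (f (fibEmb id j i)) (f j)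
    rw [h2]

end

end MulticatData

/-- A symmetric weak multicategory without the equations. -/
structure WeakMulticatData extends MulticatData.{w, v, u} where
  /-- the associativity isomorphism `ν_{φ,ψ}` for maps `φ : I → J`, `ψ : J → K` -/
  ν {A B D : Word Ob} {Z : Ob} (φ : Fin A.len → Fin B.len) (ψ : Fin B.len → Fin D.len)
    (f : ∀ j, Hom (A.fibre φ j) (B.col j)) (g : ∀ k, Hom (B.fibre ψ k) (D.col k)) (h : Hom D Z) :
    (toMulticatData.comp (ψ ∘ φ)).obj (fun k => (toMulticatData.compAt φ ψ k).obj (f, g k), h) ≅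
      (toMulticatData.comp φ).obj (f, (toMulticatData.comp ψ).obj (g, h))
  /-- the left unit isomorphism `θ_I`, for the identity map of `I` -/
  θ {A : Word Ob} {Z : Ob} (f : Hom A Z) :
    (toMulticatData.comp (B := A) id).obj (toMulticatData.ones A, f) ≅ f
  /-- the right unit isomorphism `ζ_I`, for the map of `I` to a one-element set -/
  ζ {A : Word Ob} {Z : Ob} (f : Hom A Z) :
    (μ (B := Word.single Z) (fun _ => (0 : Fin 1)) (fun _ => A) A.eq_fibre_const).obj
      (fun _ => f, one Z) ≅ f

namespace WeakMulticatData

variable (C : WeakMulticatData.{w, v, u})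

/-- For maps `φ : I → J`, `ψ : J → K`, `ξ : K → L` and `l ∈ L`, the isomorphism `ν` for the
restricted maps `φ⁻¹ ψ⁻¹ ξ⁻¹ l → ψ⁻¹ ξ⁻¹ l → ξ⁻¹ l`. -/
def νAt {A B D : Word C.Ob} {p : ℕ} {Z : C.Ob} (φ : Fin A.len → Fin B.len)
    (ψ : Fin B.len → Fin D.len) (ξ : Fin D.len → Fin p) (l : Fin p)
    (f : ∀ j, C.Hom (A.fibre φ j) (B.col j)) (g : ∀ k, C.Hom (B.fibre ψ k) (D.col k))
    (h : C.Hom (D.fibre ξ l) Z) :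
    (C.compAt (ψ ∘ φ) ξ l).obj (fun k => (C.compAt φ ψ k).obj (f, g k), h) ≅
      (C.compAt φ (ξ ∘ ψ) l).obj (f, (C.compAt ψ ξ l).obj (g, h)) :=
  eqToIso (C.comp_compAt_restrict φ ψ ξ l f g h) ≪≫
    C.ν (A := A.fibre (ξ ∘ ψ ∘ φ) l) (B := B.fibre (ξ ∘ ψ) l) (D := D.fibre ξ l)
      (fibRestr φ (ξ ∘ ψ) l) (fibRestr ψ ξ l) (C.restrict φ (ξ ∘ ψ) l f) (C.restrict ψ ξ l g) h ≪≫
    eqToIso (C.comp_comp_restrict φ ψ ξ l f g h)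

/-- For a map `φ : I → J` and `j ∈ J`, the isomorphism `θ_{φ⁻¹ j}`. -/
def θAt {A : Word C.Ob} {p : ℕ} {Z : C.Ob} (φ : Fin A.len → Fin p) (j : Fin p)
    (f : C.Hom (A.fibre φ j) Z) : (C.compAt id φ j).obj (C.ones A, f) ≅ f :=
  eqToIso (C.compAt_ones φ j f) ≪≫ C.θ f

/-- For a map `φ : I → J` and `j ∈ J`, the isomorphism `ζ_{φ⁻¹ j}`. -/
def ζAt {A B : Word C.Ob} (φ : Fin A.len → Fin B.len) (f : ∀ j, C.Hom (A.fibre φ j) (B.col j))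
    (j : Fin B.len) : (C.compAt φ id j).obj (f, C.ones B j) ≅ f j :=
  eqToIso (C.compAt_id_ones φ f j) ≪≫ C.ζ (f j)

end WeakMulticatData

open scoped CategoryTheory.Prod

/-- A symmetric weak multicategory. -/
structure SymWeakMulticat extends WeakMulticatData.{w, v, u} where
  ν_naturality {A B D : Word Ob} {Z : Ob} (φ : Fin A.len → Fin B.len) (ψ : Fin B.len → Fin D.len)
    {f f' : ∀ j, Hom (A.fibre φ j) (B.col j)} {g g' : ∀ k, Hom (B.fibre ψ k) (D.col k)}
    {h h' : Hom D Z} (α : f ⟶ f') (β : g ⟶ g') (γ : h ⟶ h') :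
    (toMulticatData.comp (ψ ∘ φ)).map
        ((show (fun k => (toMulticatData.compAt φ ψ k).obj (f, g k)) ⟶
            (fun k => (toMulticatData.compAt φ ψ k).obj (f', g' k)) from
          fun k => (toMulticatData.compAt φ ψ k).map (α ×ₘ β k)) ×ₘ γ) ≫ (ν φ ψ f' g' h').hom =
      (ν φ ψ f g h).hom ≫ (toMulticatData.comp φ).map (α ×ₘ (toMulticatData.comp ψ).map (β ×ₘ γ))
  θ_naturality {A : Word Ob} {Z : Ob} {f f' : Hom A Z} (α : f ⟶ f') :
    (toMulticatData.comp (B := A) id).map (𝟙 (toMulticatData.ones A) ×ₘ α) ≫ (θ f').hom =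
      (θ f).hom ≫ α
  ζ_naturality {A : Word Ob} {Z : Ob} {f f' : Hom A Z} (α : f ⟶ f') :
    (μ (B := Word.single Z) (fun _ => (0 : Fin 1)) (fun _ => A) A.eq_fibre_const).map
        ((show (fun _ => f) ⟶ (fun _ => f') from fun _ => α) ×ₘ 𝟙 (one Z)) ≫ (ζ f').hom =
      (ζ f).hom ≫ α
  /-- the pentagon for maps `φ : I → J`, `ψ : J → K`, `ξ : K → L` -/
  pentagon {A B D E : Word Ob} {Z : Ob} (φ : Fin A.len → Fin B.len) (ψ : Fin B.len → Fin D.len)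
    (ξ : Fin D.len → Fin E.len) (f : ∀ j, Hom (A.fibre φ j) (B.col j))
    (g : ∀ k, Hom (B.fibre ψ k) (D.col k)) (h : ∀ l, Hom (D.fibre ξ l) (E.col l)) (p : Hom E Z) :
    (toMulticatData.comp (ξ ∘ ψ ∘ φ)).map
        ((show (fun l => (toMulticatData.compAt (ψ ∘ φ) ξ l).obj
              (fun k => (toMulticatData.compAt φ ψ k).obj (f, g k), h l)) ⟶
            (fun l => (toMulticatData.compAt φ (ξ ∘ ψ) l).obj
              (f, (toMulticatData.compAt ψ ξ l).obj (g, h l))) from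
          fun l => (toWeakMulticatData.νAt φ ψ ξ l f g (h l)).hom) ×ₘ 𝟙 p) ≫
      (ν φ (ξ ∘ ψ) f (fun l => (toMulticatData.compAt ψ ξ l).obj (g, h l)) p).hom ≫
      (toMulticatData.comp φ).map (𝟙 f ×ₘ (ν ψ ξ g h p).hom) =
    (ν (ψ ∘ φ) ξ (fun k => (toMulticatData.compAt φ ψ k).obj (f, g k)) h p).hom ≫
      (ν φ ψ f g ((toMulticatData.comp ξ).obj (h, p))).hom
  /-- the triangle for a map `φ : I → J` -/
  triangle {A B : Word Ob} {Z : Ob} (φ : Fin A.len → Fin B.len)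
    (f : ∀ j, Hom (A.fibre φ j) (B.col j)) (g : Hom B Z) :
    (ν φ id f (toMulticatData.ones B) g).hom ≫ (toMulticatData.comp φ).map (𝟙 f ×ₘ (θ g).hom) =
      (toMulticatData.comp φ).map
        ((show (fun j => (toMulticatData.compAt φ id j).obj (f, toMulticatData.ones B j)) ⟶ f from
          fun j => (toWeakMulticatData.ζAt φ f j).hom) ×ₘ 𝟙 g)

/-- The data of a biprop with set of colours `S`: categories `P(A; B)` indexed by pairs of words,
units, composition functors, associators, unitors and tensor products. -/
structure BipropData (S : Type u) where
  /-- the category `P(A; B)` -/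
  Hom : Word S → Word S → Type v
  [cat : ∀ A B, Category.{w} (Hom A B)]
  /-- the unit 1-morphism `1_A` -/
  one : ∀ A, Hom A A
  /-- the composition functor -/
  m {A B D : Word S} : Hom A B × Hom B D ⥤ Hom A D
  /-- the associator -/
  a {A B D E : Word S} (f : Hom A B) (g : Hom B D) (h : Hom D E) :
    m.obj (m.obj (f, g), h) ≅ m.obj (f, m.obj (g, h))
  /-- the left unitor -/
  l {A B : Word S} (f : Hom A B) : m.obj (one A, f) ≅ f
  /-- the right unitor -/
  r {A B : Word S} (f : Hom A B) : m.obj (f, one B) ≅ f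
  /-- the tensor product `⊗^{I → L ← J}` indexed by a cospan of maps -/
  tensor {I J L : ℕ} (f : Fin I → Fin L) (g : Fin J → Fin L) (A : Fin I → Word S)
    (B : Fin J → Word S) :
    (∀ l, Hom (Word.concatFib A f l) (Word.concatFib B g l)) ⥤ Hom (Word.concat A) (Word.concat B)

namespace BipropData

attribute [instance] BipropData.cat

variable {S : Type u} (P : BipropData.{w, v, u} S)

/-- The bicategory axioms. -/
structure IsBicategory : Prop where
  a_naturality {A B D E : Word S} {f f' : P.Hom A B} {g g' : P.Hom B D} {h h' : P.Hom D E}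
    (α : f ⟶ f') (β : g ⟶ g') (γ : h ⟶ h') :
    P.m.map (P.m.map (α ×ₘ β) ×ₘ γ) ≫ (P.a f' g' h').hom =
      (P.a f g h).hom ≫ P.m.map (α ×ₘ P.m.map (β ×ₘ γ))
  l_naturality {A B : Word S} {f f' : P.Hom A B} (α : f ⟶ f') :
    P.m.map (𝟙 (P.one A) ×ₘ α) ≫ (P.l f').hom = (P.l f).hom ≫ α
  r_naturality {A B : Word S} {f f' : P.Hom A B} (α : f ⟶ f') :
    P.m.map (α ×ₘ 𝟙 (P.one B)) ≫ (P.r f').hom = (P.r f).hom ≫ α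
  pentagon {A B D E F : Word S} (f : P.Hom A B) (g : P.Hom B D) (h : P.Hom D E) (i : P.Hom E F) :
    P.m.map ((P.a f g h).hom ×ₘ 𝟙 i) ≫ (P.a f (P.m.obj (g, h)) i).hom ≫
        P.m.map (𝟙 f ×ₘ (P.a g h i).hom) =
      (P.a (P.m.obj (f, g)) h i).hom ≫ (P.a f g (P.m.obj (h, i))).hom
  triangle {A B D : Word S} (f : P.Hom A B) (g : P.Hom B D) :
    (P.a f (P.one B) g).hom ≫ P.m.map (𝟙 f ×ₘ (P.l g).hom) = P.m.map ((P.r f).hom ×ₘ 𝟙 g)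

/-- The identity functor, for equal words. -/
def castFunctor {A A' B B' : Word S} (hA : A = A') (hB : B = B') : P.Hom A B ⥤ P.Hom A' B' :=
  match A', B', hA, hB with
  | _, _, rfl, rfl => 𝟭 _

/-- Tensor products commute strictly with compositions. -/
def TensorComp : Prop :=
  ∀ {I J K L : ℕ} (f : Fin I → Fin L) (g : Fin J → Fin L) (h : Fin K → Fin L)
    (A : Fin I → Word S) (B : Fin J → Word S) (D : Fin K → Word S),
    (P.tensor f g A B).prod (P.tensor g h B D) ⋙ P.m =
      Functor.pi' (fun l => (Pi.eval _ l).prod (Pi.eval _ l) ⋙ P.m) ⋙ P.tensor f h A D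

/-- Tensor products preserve units strictly. -/
def TensorOne : Prop :=
  ∀ {I L : ℕ} (f : Fin I → Fin L) (A : Fin I → Word S),
    (P.tensor f f A A).obj (fun l => P.one (Word.concatFib A f l)) = P.one (Word.concat A)

section

variable {P} {I J K M L : ℕ} {f : Fin I → Fin L} {g : Fin J → Fin L} {h : Fin K → Fin L}
  {e : Fin M → Fin L} {A : Fin I → Word S} {B : Fin J → Word S} {D : Fin K → Word S}
  {E : Fin M → Word S}
  (F : ∀ l, P.Hom (Word.concatFib A f l) (Word.concatFib B g l))
  (G : ∀ l, P.Hom (Word.concatFib B g l) (Word.concatFib D h l))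
  (H : ∀ l, P.Hom (Word.concatFib D h l) (Word.concatFib E e l))

theorem TensorComp.obj (hP : P.TensorComp) :
    P.m.obj ((P.tensor f g A B).obj F, (P.tensor g h B D).obj G) =
      (P.tensor f h A D).obj (fun l => P.m.obj (F l, G l)) :=
  Functor.congr_obj (hP f g h A B D) (F, G)

theorem TensorComp.obj_left (hP : P.TensorComp) :
    P.m.obj (P.m.obj ((P.tensor f g A B).obj F, (P.tensor g h B D).obj G),
        (P.tensor h e D E).obj H) =
      (P.tensor f e A E).obj (fun l => P.m.obj (P.m.obj (F l, G l), H l)) := by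
  rw [hP.obj, hP.obj]

theorem TensorComp.obj_right (hP : P.TensorComp) :
    P.m.obj ((P.tensor f g A B).obj F,
        P.m.obj ((P.tensor g h B D).obj G, (P.tensor h e D E).obj H)) =
      (P.tensor f e A E).obj (fun l => P.m.obj (F l, P.m.obj (G l, H l))) := by
  rw [hP.obj, hP.obj]

theorem TensorComp.one_obj (hP : P.TensorComp) (hP' : P.TensorOne) :
    P.m.obj (P.one (Word.concat A), (P.tensor f g A B).obj F) =
      (P.tensor f g A B).obj (fun l => P.m.obj (P.one (Word.concatFib A f l), F l)) := by
  rw [← hP' f A, hP.obj]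

theorem TensorComp.obj_one (hP : P.TensorComp) (hP' : P.TensorOne) :
    P.m.obj ((P.tensor f g A B).obj F, P.one (Word.concat B)) =
      (P.tensor f g A B).obj (fun l => P.m.obj (F l, P.one (Word.concatFib B g l))) := by
  rw [← hP' g B, hP.obj]

end

/-- The axioms of a biprop. -/
structure IsBiprop : Prop extends P.IsBicategory where
  /-- the tensor product is strictly compatible with compositions -/
  tensor_comp : P.TensorComp
  /-- the tensor product is compatible with associators -/
  tensor_a {I J K M N : ℕ} (f : Fin I → Fin N) (g : Fin J → Fin N) (h : Fin K → Fin N)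
    (e : Fin M → Fin N) (A : Fin I → Word S) (B : Fin J → Word S) (D : Fin K → Word S)
    (E : Fin M → Word S)
    (F : ∀ n, P.Hom (Word.concatFib A f n) (Word.concatFib B g n))
    (G : ∀ n, P.Hom (Word.concatFib B g n) (Word.concatFib D h n))
    (H : ∀ n, P.Hom (Word.concatFib D h n) (Word.concatFib E e n)) :
    (P.a ((P.tensor f g A B).obj F) ((P.tensor g h B D).obj G) ((P.tensor h e D E).obj H)).hom =
      eqToHom (tensor_comp.obj_left F G H) ≫
        (P.tensor f e A E).map (fun n => (P.a (F n) (G n) (H n)).hom) ≫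
          eqToHom (tensor_comp.obj_right F G H).symm
  /-- the tensor product over a one-element set is the identity functor -/
  tensor_terminal {I J : ℕ} (A : Fin I → Word S) (B : Fin J → Word S) :
    Functor.pi' (fun l : Fin 1 =>
        P.castFunctor (Word.concatFib_const A l) (Word.concatFib_const B l)) ⋙
      P.tensor (fun _ => 0) (fun _ => 0) A B = 𝟭 (P.Hom (Word.concat A) (Word.concat B))
  /-- the tensor product strictly preserves units -/
  tensor_one : P.TensorOne
  /-- the tensor product is compatible with left unitors -/
  tensor_l {I J K : ℕ} (f : Fin I → Fin K) (g : Fin J → Fin K) (A : Fin I → Word S)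
    (B : Fin J → Word S) (F : ∀ k, P.Hom (Word.concatFib A f k) (Word.concatFib B g k)) :
    (P.l ((P.tensor f g A B).obj F)).hom =
      eqToHom (tensor_comp.one_obj F tensor_one) ≫
        (P.tensor f g A B).map (fun k => (P.l (F k)).hom)
  /-- the tensor product is compatible with right unitors -/
  tensor_r {I J K : ℕ} (f : Fin I → Fin K) (g : Fin J → Fin K) (A : Fin I → Word S)
    (B : Fin J → Word S) (F : ∀ k, P.Hom (Word.concatFib A f k) (Word.concatFib B g k)) :
    (P.r ((P.tensor f g A B).obj F)).hom =
      eqToHom (tensor_comp.obj_one F tensor_one) ≫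
        (P.tensor f g A B).map (fun k => (P.r (F k)).hom)
  /-- strictness of tensor multiplication: for `f : I → K`, `g : J → K`, `h : K → L` the product
  `⊗^{I → K ← J}` equals the composition of the products `⊗^{(fh)⁻¹ l → h⁻¹ l ← (gh)⁻¹ l}`, `l ∈ L`,
  with the product `⊗^{I → L ← J}` -/
  tensor_tensor {I J K L : ℕ} (f : Fin I → Fin K) (g : Fin J → Fin K) (h : Fin K → Fin L)
    (A : Fin I → Word S) (B : Fin J → Word S) :
    Functor.pi' (fun l => Functor.pi' (fun k => Pi.eval _ (fibEmb h l k) ⋙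
          P.castFunctor (Word.concatFib_fibRestr A f h l k) (Word.concatFib_fibRestr B g h l k)) ⋙
        P.tensor (fibRestr f h l) (fibRestr g h l) (fun i => A (fibEmb (h ∘ f) l i))
          (fun j => B (fibEmb (h ∘ g) l j))) ⋙
      P.tensor (h ∘ f) (h ∘ g) A B = P.tensor f g A B

/-- The bicategory, in the sense of Mathlib, given by data satisfying the bicategory axioms. -/
@[reducible]
def IsBicategory.toBicategory {P : BipropData.{w, v, u} S} (hP : P.IsBicategory) :
    Bicategory.{w, v} (Word S) where
  Hom := P.Hom
  id := P.one
  comp f g := P.m.obj (f, g)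
  homCategory := P.cat
  whiskerLeft f _ _ η := P.m.map (𝟙 f ×ₘ η)
  whiskerRight η h := P.m.map (η ×ₘ 𝟙 h)
  associator := P.a
  leftUnitor := P.l
  rightUnitor := P.r
  whiskerLeft_id f g := P.m.map_id (f, g)
  whiskerLeft_comp f _ _ _ η θ := by rw [← P.m.map_comp]; simp
  id_whiskerLeft η := by
    rw [← Category.assoc, ← hP.l_naturality, Category.assoc, Iso.hom_inv_id, Category.comp_id]
  comp_whiskerLeft f g _ _ η := by
    rw [← Category.assoc, ← hP.a_naturality, Category.assoc, Iso.hom_inv_id, Category.comp_id]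
    congr 1
    exact congrArg (· ×ₘ η) (P.m.map_id (f, g)).symm
  id_whiskerRight f g := P.m.map_id (f, g)
  comp_whiskerRight η θ i := by rw [← P.m.map_comp]; simp
  whiskerRight_id η := by
    rw [← Category.assoc, ← hP.r_naturality, Category.assoc, Iso.hom_inv_id, Category.comp_id]
  whiskerRight_comp η g h := by
    rw [hP.a_naturality, Iso.inv_hom_id_assoc]
    congr 1
    exact congrArg (η ×ₘ ·) (P.m.map_id (g, h)).symm
  whisker_assoc f _ _ η h := by
    rw [← Category.assoc, ← hP.a_naturality, Category.assoc, Iso.hom_inv_id, Category.comp_id]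
  whisker_exchange η θ := by rw [← P.m.map_comp, ← P.m.map_comp]; simp
  pentagon := hP.pentagon
  triangle := hP.triangle

end BipropData

section Distrib

theorem sigma_fst {T : Type} {X : T → Type v} [∀ t, Category.{w} (X t)] :
    ∀ {F G : Σ t, X t}, (F ⟶ G) → F.1 = G.1
  | _, _, Sigma.SigmaHom.mk _ => rfl

/-- The morphism of a summand underlying a morphism of a disjoint union of categories. -/
def sigmaSnd {T : Type} {X : T → Type v} [∀ t, Category.{w} (X t)] {t : T} {x y : X t} :
    ((⟨t, x⟩ : Σ t, X t) ⟶ ⟨t, y⟩) → (x ⟶ y)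
  | Sigma.SigmaHom.mk α => α

variable {K : Type} {T : K → Type} {X : ∀ k, T k → Type v} [∀ k t, Category.{w} (X k t)]

/-- The action of `distrib` on morphisms. -/
def distribHom {t t' : ∀ k, T k} (h : t = t') {x : ∀ k, X k (t k)} {y : ∀ k, X k (t' k)}
    (η : ∀ k, (⟨t k, x k⟩ : Σ t, X k t) ⟶ ⟨t' k, y k⟩) :
    (⟨t, x⟩ : Σ t : ∀ k, T k, ∀ k, X k (t k)) ⟶ ⟨t', y⟩ :=
  match t', h, y, η with
  | _, rfl, _, η => Sigma.SigmaHom.mk fun k => sigmaSnd (η k)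

/-- The canonical isomorphism `∏_k ∐_{t ∈ T_k} X_{k,t} ≅ ∐_{(t_k) ∈ ∏_k T_k} ∏_k X_{k,t_k}`. -/
def distrib : (∀ k, Σ t : T k, X k t) ⥤ Σ t : ∀ k, T k, ∀ k, X k (t k) where
  obj F := ⟨fun k => (F k).1, fun k => (F k).2⟩
  map {F G} η := distribHom (funext fun k => sigma_fst (η k)) η
  map_id _ := rfl
  map_comp {F G H} η θ := by
    have key : ∀ {t t' t'' : ∀ k, T k} (h : t = t') (h' : t' = t'') {x : ∀ k, X k (t k)}
        {y : ∀ k, X k (t' k)} {z : ∀ k, X k (t'' k)}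
        (η : ∀ k, (⟨t k, x k⟩ : Σ t, X k t) ⟶ ⟨t' k, y k⟩)
        (θ : ∀ k, (⟨t' k, y k⟩ : Σ t, X k t) ⟶ ⟨t'' k, z k⟩),
        distribHom (h.trans h') (fun k => η k ≫ θ k) = distribHom h η ≫ distribHom h' θ := by
      rintro t _ _ rfl rfl x y z η θ
      refine congrArg Sigma.SigmaHom.mk (funext fun k => ?_)
      have : ∀ (η : (⟨t k, x k⟩ : Σ t, X k t) ⟶ ⟨t k, y k⟩)
          (θ : (⟨t k, y k⟩ : Σ t, X k t) ⟶ ⟨t k, z k⟩),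
          sigmaSnd (η ≫ θ) = sigmaSnd η ≫ sigmaSnd θ := by
        rintro ⟨α⟩ ⟨β⟩
        rfl
      exact this _ _
    exact key _ _ η θ

end Distrib

namespace SymWeakMulticat

variable (C : SymWeakMulticat.{w, v, u})

/-- The category `∐_{φ : I → J} ∏_{j ∈ J} C((X_i)_{i ∈ φ⁻¹ j}; Y_j)`. -/
abbrev EnvHom (A B : Word C.Ob) : Type v :=
  Σ φ : Fin A.len → Fin B.len, ∀ j, C.Hom (A.fibre φ j) (B.col j)

/-- The unit: the family of units of `C`, indexed by the identity map. -/
def envOne (A : Word C.Ob) : C.EnvHom A A := ⟨id, C.ones A⟩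

/-- Composition: on the summand indexed by `I → J → K` the product over `k ∈ K` of the functors
`μ_{φ⁻¹ ψ⁻¹ k → ψ⁻¹ k}`. -/
def envComp {A B D : Word C.Ob} : C.EnvHom A B × C.EnvHom B D ⥤ C.EnvHom A D where
  obj F := ⟨F.2.1 ∘ F.1.1, fun k => (C.compAt F.1.1 F.2.1 k).obj (F.1.2, F.2.2 k)⟩
  map {F G} η :=
    match F, G, η with
    | (⟨φ, _⟩, ⟨ψ, _⟩), (⟨_, _⟩, ⟨_, _⟩), (Sigma.SigmaHom.mk α, Sigma.SigmaHom.mk β) =>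
      Sigma.SigmaHom.mk fun k => (C.compAt φ ψ k).map (α ×ₘ β k)
  map_id F := by
    obtain ⟨⟨φ, f⟩, ⟨ψ, g⟩⟩ := F
    exact congrArg Sigma.SigmaHom.mk (funext fun k => (C.compAt φ ψ k).map_id (f, g k))
  map_comp {F G H} η θ := by
    obtain ⟨⟨φ, f⟩, ⟨ψ, g⟩⟩ := F
    obtain ⟨⟨φ', f'⟩, ⟨ψ', g'⟩⟩ := G
    obtain ⟨⟨φ'', f''⟩, ⟨ψ'', g''⟩⟩ := H
    obtain ⟨⟨α⟩, ⟨β⟩⟩ := η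
    obtain ⟨⟨α'⟩, ⟨β'⟩⟩ := θ
    exact congrArg Sigma.SigmaHom.mk (funext fun k =>
      (C.compAt φ ψ k).map_comp (α ×ₘ β k) (α' ×ₘ β' k))

/-- The isomorphism in `EnvHom A B` given by a family of isomorphisms in the summand indexed by `φ`. -/
def sigmaIso {A B : Word C.Ob} (φ : Fin A.len → Fin B.len)
    {f g : ∀ j, C.Hom (A.fibre φ j) (B.col j)} (α : ∀ j, f j ≅ g j) :
    (⟨φ, f⟩ : C.EnvHom A B) ≅ ⟨φ, g⟩ :=
  (Sigma.incl (C := fun φ : Fin A.len → Fin B.len => ∀ j, C.Hom (A.fibre φ j) (B.col j)) φ).mapIso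
    (Pi.isoMk α)

/-- The tensor product: the summand indexed by a family
`φ_k : ⊔_{i ∈ f⁻¹ k} S_i → ⊔_{j ∈ g⁻¹ k} Q_j`, `k ∈ K`, is mapped identically to the summand indexed
by the map `φ : ⊔_{i ∈ I} S_i → ⊔_{j ∈ J} Q_j` over `K` glued from `(φ_k)`. -/
def envTensor {I J K : ℕ} (f : Fin I → Fin K) (g : Fin J → Fin K) (A : Fin I → Word C.Ob)
    (B : Fin J → Word C.Ob) :
    (∀ k, C.EnvHom (Word.concatFib A f k) (Word.concatFib B g k)) ⥤
      C.EnvHom (Word.concat A) (Word.concat B) :=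
  distrib ⋙ Sigma.desc fun φ =>
    (Functor.pi' fun q => Pi.eval _ (Word.blk B g q) ⋙
      Pi.eval _ (Word.blkIdx B g (Word.blk B g q) q rfl) ⋙
        C.castFunctor (Word.fibre_glue_blkIdx f g A B φ q) (Word.col_blkIdx g B q)) ⋙
    Sigma.incl (C := fun ξ : Fin (Word.concat A).len → Fin (Word.concat B).len =>
      ∀ q, C.Hom ((Word.concat A).fibre ξ q) ((Word.concat B).col q)) (Word.glue f g A B φ)

/-- The data of the biprop envelope of `C`. Its objects are the words in `Ob C`. On the summand
indexed by `φ : I → J`, `ψ : J → K`, `ξ : K → L` the associator is the product over `l ∈ L` of the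
isomorphisms `ν` for the maps `φ⁻¹ ψ⁻¹ ξ⁻¹ l → ψ⁻¹ ξ⁻¹ l → ξ⁻¹ l`. On the summand indexed by
`φ : I → J` the unitors are the products over `j ∈ J` of `θ_{φ⁻¹ j}`, respectively `ζ_{φ⁻¹ j}`. -/
def envelope : BipropData.{max v w, v, u} C.Ob where
  Hom := C.EnvHom
  one := C.envOne
  m := C.envComp
  a F G H := C.sigmaIso (H.1 ∘ G.1 ∘ F.1) fun l => C.νAt F.1 G.1 H.1 l F.2 G.2 (H.2 l)
  l F := C.sigmaIso F.1 fun j => C.θAt F.1 j (F.2 j)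
  r F := C.sigmaIso F.1 fun j => C.ζAt F.1 F.2 j
  tensor := C.envTensor

end SymWeakMulticat
end BipropEnvelope

/-!
The envelope of a symmetric weak multicategory is computed fibre by fibre: a 1-morphism over
`φ : I → J` is a family indexed by `J`, and the component over `k` of a composition, an associator
or a unitor is the corresponding operation of the multicategory for the maps restricted to the
fibres over `k`. Hence each axiom of a biprop, read in one component, is either an axiom of the
multicategory for restricted maps or the assertion that an operation depends only on the fibres
which enter it.

The latter assertion has one common form. Say that `φ'` is a restriction of `φ` along injections
`e`, `e'` if the square they form is a pullback and `e` is increasing (`IsRestriction`). Then `φ'`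
and `φ` have the same fibres, in the same order, over corresponding points, so composition functors
and associativity isomorphisms of restrictions are those of the original maps
(`MulticatData.compAt_map_heq`, `WeakMulticatData.νAt_hom_heq`). This is applied to two kinds of
squares:

* the restriction of maps to the fibres over an element of a further target
  (`isRestriction_fibRestr`), which turns the axioms of the multicategory for the restricted maps
  into the pentagon and the triangle (`SymWeakMulticat.νAt_pentagon`,
  `SymWeakMulticat.νAt_triangle`);
* the inclusion of a block into a concatenation, where the glued map restricts to the given maps
  (`Word.isRestriction_glue`), which yields the compatibility of tensor products with compositions,
  associators and unitors, while strictness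
  of tensor multiplication reduces to the fact that a block of a block is a block
  (`Word.blkEmb_blkEmb`).

The words involved are often equal only propositionally. Morphisms over such words are compared by
heterogeneous equality of the corresponding objects of arrow categories: one such equality contains
those of the sources, of the targets and of the morphisms, so it composes without transport, and
an equality of functors reduces to equalities of arrows (`Arrow.functor_ext`).
-/

namespace BipropEnvelope

open scoped CategoryTheory.Prod

/-! ### Restrictions of maps of finite ordinals -/

/-- The map `φ' : I' → J'` is a restriction of `φ : I → J`, along an increasing injection
`e : I' → I` and an injection `e' : J' → J`: the square formed by these maps is a pullback square,
that is, `e` identifies the fibres of `φ'` with the fibres of `φ` over the image of `e'`. -/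
structure IsRestriction {n' n m' m : ℕ} (e : Fin n' → Fin n) (e' : Fin m' → Fin m)
    (φ' : Fin n' → Fin m') (φ : Fin n → Fin m) : Prop where
  strictMono : StrictMono e
  injective : Function.Injective e'
  comm : ∀ i, φ (e i) = e' (φ' i)
  exists_eq : ∀ i j, φ i = e' j → ∃ i', e i' = i

namespace IsRestriction

variable {n' n m' m p' p : ℕ} {e : Fin n' → Fin n} {e' : Fin m' → Fin m} {e'' : Fin p' → Fin p}
  {φ' : Fin n' → Fin m'} {φ : Fin n → Fin m} {ψ' : Fin m' → Fin p'} {ψ : Fin m → Fin p}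

theorem comp (hφ : IsRestriction e e' φ' φ) (hψ : IsRestriction e' e'' ψ' ψ) :
    IsRestriction e e'' (ψ' ∘ φ') (ψ ∘ φ) where
  strictMono := hφ.strictMono
  injective := hψ.injective
  comm i := by simp [hφ.comm, hψ.comm]
  exists_eq i k h := by
    obtain ⟨j, hj⟩ := hψ.exists_eq (φ i) k h
    exact hφ.exists_eq i j hj.symm

/-- A restriction has the fibres of the original map, in the same order. -/
theorem enum_fib (hφ : IsRestriction e e' φ' φ) (j : Fin m') :
    fibCard φ' j = fibCard φ (e' j) ∧
      ∀ (i : Fin (fibCard φ' j)) (i' : Fin (fibCard φ (e' j))), i.val = i'.val →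
        e (fibEmb φ' j i) = fibEmb φ (e' j) i' := by
  refine BipropEnvelope.enum_fib (e := e ∘ fibEmb φ' j)
    (hφ.strictMono.comp (fibEmb φ' j).strictMono) fun i => ⟨?_, fun h => ?_⟩
  · rintro ⟨x, rfl⟩
    exact (hφ.comm _).trans (congrArg e' (apply_fibEmb φ' j x))
  · obtain ⟨x, rfl⟩ := hφ.exists_eq i j h
    refine ⟨fibIdx φ' j x (hφ.injective ((hφ.comm x).symm.trans h)), ?_⟩
    simp [fibEmb_fibIdx]

/-- Restrictions of composable maps induce the same maps between fibres as the original maps. -/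
theorem fibRestr_val (hφ : IsRestriction e e' φ' φ) (hψ : IsRestriction e' e'' ψ' ψ) {k : Fin p'}
    {i : Fin (fibCard (ψ' ∘ φ') k)} {i' : Fin (fibCard (ψ ∘ φ) (e'' k))} (hi : i.val = i'.val) :
    (fibRestr φ' ψ' k i).val = (fibRestr φ ψ (e'' k) i').val := by
  obtain ⟨h1, h2⟩ := hψ.enum_fib k
  suffices h : Fin.cast h1 (fibRestr φ' ψ' k i) = fibRestr φ ψ (e'' k) i' from congrArg Fin.val h
  apply (fibEmb ψ (e'' k)).injective
  rw [← h2 (fibRestr φ' ψ' k i) _ rfl, fibEmb_fibRestr, fibEmb_fibRestr, ← hφ.comm]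
  exact congrArg φ (((hφ.comp hψ).enum_fib k).2 i i' hi)

theorem fibre_eq {S : Type u} {A' A : Word S} {eA : Fin A'.len → Fin A.len}
    {φ' : Fin A'.len → Fin m'} {φ : Fin A.len → Fin m} (hφ : IsRestriction eA e' φ' φ)
    (hA : ∀ i, A'.col i = A.col (eA i)) (j : Fin m') : A'.fibre φ' j = A.fibre φ (e' j) :=
  Word.eq_of (hφ.enum_fib j).1 fun i i' hi => by
    simp only [hA, (hφ.enum_fib j).2 i i' hi]

end IsRestriction

/-- The restriction of a map to the fibres over an element of the target of a second map. -/
theorem isRestriction_fibRestr {n m p : ℕ} (φ : Fin n → Fin m) (ψ : Fin m → Fin p) (k : Fin p) :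
    IsRestriction (fibEmb (ψ ∘ φ) k) (fibEmb ψ k) (fibRestr φ ψ k) φ where
  strictMono := (fibEmb (ψ ∘ φ) k).strictMono
  injective := (fibEmb ψ k).injective
  comm i := (fibEmb_fibRestr φ ψ k i).symm
  exists_eq i j h := ⟨fibIdx (ψ ∘ φ) k i (by simp [h, apply_fibEmb]), fibEmb_fibIdx _ _ _ _⟩

/-! ### Congruence of the operations of a symmetric weak multicategory -/

section Arrows

theorem arrow_comp_congr {T : Type v} [Category.{w} T] {X Y Z X' Y' Z' : T} {f : X ⟶ Y} {g : Y ⟶ Z}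
    {f' : X' ⟶ Y'} {g' : Y' ⟶ Z'} (hf : Arrow.mk f = Arrow.mk f') (hg : Arrow.mk g = Arrow.mk g') :
    Arrow.mk (f ≫ g) = Arrow.mk (f' ≫ g') := by
  obtain rfl : X = X' := congrArg Comma.left hf
  obtain rfl : Y = Y' := congrArg Comma.right hf
  obtain rfl : Z = Z' := congrArg Comma.right hg
  rw [Arrow.mk_injective _ _ hf, Arrow.mk_injective _ _ hg]

theorem eq_eqToHom_comp_comp_iff {T : Type v} [Category.{w} T] {X Y X' Y' : T} {f : X ⟶ Y}
    {f' : X' ⟶ Y'} (hX : X = X') (hY : Y' = Y) :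
    f = eqToHom hX ≫ f' ≫ eqToHom hY ↔ Arrow.mk f = Arrow.mk f' := by
  subst hX hY
  simp [Arrow.mk_inj]

theorem eq_eqToHom_comp_iff {T : Type v} [Category.{w} T] {X Y X' : T} {f : X ⟶ Y}
    {f' : X' ⟶ Y} (hX : X = X') :
    f = eqToHom hX ≫ f' ↔ Arrow.mk f = Arrow.mk f' := by
  subst hX
  simp [Arrow.mk_inj]

end Arrows

namespace MulticatData

variable (C : MulticatData.{w, v, u})

theorem castFunctor_obj_heq {A A' : Word C.Ob} {Y Y' : C.Ob} (hA : A = A') (hY : Y = Y')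
    (x : C.Hom A Y) : HEq ((C.castFunctor hA hY).obj x) x := by
  subst hA hY; rfl

theorem castFunctor_map_heq {A A' : Word C.Ob} {Y Y' : C.Ob} (hA : A = A') (hY : Y = Y')
    {x y : C.Hom A Y} (α : x ⟶ y) :
    HEq (Arrow.mk ((C.castFunctor hA hY).map α)) (Arrow.mk α) := by
  subst hA hY; rfl

theorem arrow_id_heq {A A' : Word C.Ob} {Y Y' : C.Ob} (hA : A = A') (hY : Y = Y')
    {x : C.Hom A Y} {x' : C.Hom A' Y'} (h : HEq x x') :
    HEq (Arrow.mk (𝟙 x)) (Arrow.mk (𝟙 x')) := by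
  subst hA hY
  rw [eq_of_heq h]

/-- Families of morphisms are equal when their members are. -/
theorem arrow_pi_congr {K : Type} {A : K → Word C.Ob} {Y : K → C.Ob}
    {x y x' y' : ∀ k, C.Hom (A k) (Y k)} {α : x ⟶ y} {α' : x' ⟶ y'}
    (h : ∀ k, Arrow.mk (α k) = Arrow.mk (α' k)) : Arrow.mk α = Arrow.mk α' := by
  obtain rfl : x = x' := funext fun k => congrArg Comma.left (h k)
  obtain rfl : y = y' := funext fun k => congrArg Comma.right (h k)
  obtain rfl : α = α' := funext fun k => Arrow.mk_injective _ _ (h k)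
  rfl

/-- `μ` respects equality of its arguments, on morphisms. Equality of arrows over equal words
includes the equality of the sources and of the targets. -/
theorem μ_map_heq {A A' B B' : Word C.Ob} {Z Z' : C.Ob} {φ : Fin A.len → Fin B.len}
    {φ' : Fin A'.len → Fin B'.len} {U : Fin B.len → Word C.Ob} {U' : Fin B'.len → Word C.Ob}
    {hU : ∀ j, U j = A.fibre φ j} {hU' : ∀ j, U' j = A'.fibre φ' j}
    {x y : ∀ j, C.Hom (U j) (B.col j)} {x' y' : ∀ j, C.Hom (U' j) (B'.col j)}
    {s t : C.Hom B Z} {s' t' : C.Hom B' Z'} {α : x ⟶ y} {α' : x' ⟶ y'} {β : s ⟶ t} {β' : s' ⟶ t'}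
    (hA : A = A') (hB : B = B') (hZ : Z = Z')
    (hφ : ∀ i i', i.val = i'.val → (φ i).val = (φ' i').val)
    (hα : ∀ j j', j.val = j'.val → HEq (Arrow.mk (α j)) (Arrow.mk (α' j')))
    (hβ : HEq (Arrow.mk β) (Arrow.mk β')) :
    HEq (Arrow.mk ((C.μ φ U hU).map (α ×ₘ β))) (Arrow.mk ((C.μ φ' U' hU').map (α' ×ₘ β'))) := by
  subst hA hB hZ
  obtain rfl : φ = φ' := funext fun i => Fin.ext (hφ i i rfl)
  obtain rfl : U = U' := funext fun j => (hU j).trans (hU' j).symm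
  have h := C.arrow_pi_congr fun j => eq_of_heq (hα j j rfl)
  obtain rfl : x = x' := congrArg Comma.left h
  obtain rfl : y = y' := congrArg Comma.right h
  obtain rfl : s = s' := congrArg Comma.left (eq_of_heq hβ)
  obtain rfl : t = t' := congrArg Comma.right (eq_of_heq hβ)
  rw [Arrow.mk_injective _ _ h, Arrow.mk_injective _ _ (eq_of_heq hβ)]

section

variable {A A' B B' : Word C.Ob} {p p' : ℕ} {Z Z' : C.Ob} {φ : Fin A.len → Fin B.len}
  {φ' : Fin A'.len → Fin B'.len} {ψ : Fin B.len → Fin p} {ψ' : Fin B'.len → Fin p'}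
  {eA : Fin A'.len → Fin A.len} {eB : Fin B'.len → Fin B.len} {eP : Fin p' → Fin p}

/-- The composition functor over an element `k` depends only on the fibres over `k`. -/
theorem compAt_obj_heq (hA : ∀ i, A'.col i = A.col (eA i)) (hB : ∀ i, B'.col i = B.col (eB i))
    (hφ : IsRestriction eA eB φ' φ) (hψ : IsRestriction eB eP ψ' ψ)
    {k' : Fin p'} {k : Fin p} (hk : eP k' = k) (hZ : Z' = Z)
    {x' : ∀ j, C.Hom (A'.fibre φ' j) (B'.col j)} {x : ∀ j, C.Hom (A.fibre φ j) (B.col j)}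
    (hx : ∀ j, HEq (x' j) (x (eB j)))
    {s' : C.Hom (B'.fibre ψ' k') Z'} {s : C.Hom (B.fibre ψ k) Z} (hs : HEq s' s) :
    HEq ((C.compAt φ' ψ' k').obj (x', s')) ((C.compAt φ ψ k).obj (x, s)) := by
  subst hk hZ
  refine C.μ_obj_heq ((hφ.comp hψ).fibre_eq hA k') (hψ.fibre_eq hB k')
    (fun i i' hi => hφ.fibRestr_val hψ hi) (fun j j' hj => ?_) hs
  exact (hx _).trans (congr_arg_heq x ((hψ.enum_fib k').2 j j' hj))

/-- The composition functor over an element `k` depends only on the fibres over `k`, on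
morphisms. -/
theorem compAt_map_heq (hA : ∀ i, A'.col i = A.col (eA i)) (hB : ∀ i, B'.col i = B.col (eB i))
    (hφ : IsRestriction eA eB φ' φ) (hψ : IsRestriction eB eP ψ' ψ)
    {k' : Fin p'} {k : Fin p} (hk : eP k' = k) (hZ : Z' = Z)
    {x' y' : ∀ j, C.Hom (A'.fibre φ' j) (B'.col j)} {x y : ∀ j, C.Hom (A.fibre φ j) (B.col j)}
    {α' : x' ⟶ y'} {α : x ⟶ y} (hα : ∀ j, HEq (Arrow.mk (α' j)) (Arrow.mk (α (eB j))))
    {s' t' : C.Hom (B'.fibre ψ' k') Z'} {s t : C.Hom (B.fibre ψ k) Z} {β' : s' ⟶ t'} {β : s ⟶ t}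
    (hβ : HEq (Arrow.mk β') (Arrow.mk β)) :
    HEq (Arrow.mk ((C.compAt φ' ψ' k').map (α' ×ₘ β')))
      (Arrow.mk ((C.compAt φ ψ k).map (α ×ₘ β))) := by
  subst hk hZ
  refine C.μ_map_heq ((hφ.comp hψ).fibre_eq hA k') (hψ.fibre_eq hB k') rfl
    (fun i i' hi => hφ.fibRestr_val hψ hi) (fun j j' hj => ?_) hβ
  exact (hα _).trans (congr_arg_heq (fun j => Arrow.mk (α j)) ((hψ.enum_fib k').2 j j' hj))

end

end MulticatData

namespace WeakMulticatData

variable (C : WeakMulticatData.{w, v, u})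

/-- `ν` respects equality of its arguments. -/
theorem ν_hom_heq {A A' B B' D D' : Word C.Ob} {Z Z' : C.Ob} {φ : Fin A.len → Fin B.len}
    {φ' : Fin A'.len → Fin B'.len} {ψ : Fin B.len → Fin D.len} {ψ' : Fin B'.len → Fin D'.len}
    {f : ∀ j, C.Hom (A.fibre φ j) (B.col j)} {f' : ∀ j, C.Hom (A'.fibre φ' j) (B'.col j)}
    {g : ∀ k, C.Hom (B.fibre ψ k) (D.col k)} {g' : ∀ k, C.Hom (B'.fibre ψ' k) (D'.col k)}
    {h : C.Hom D Z} {h' : C.Hom D' Z'} (hA : A = A') (hB : B = B') (hD : D = D') (hZ : Z = Z')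
    (hφ : ∀ i i', i.val = i'.val → (φ i).val = (φ' i').val)
    (hψ : ∀ i i', i.val = i'.val → (ψ i).val = (ψ' i').val)
    (hf : ∀ j j', j.val = j'.val → HEq (f j) (f' j'))
    (hg : ∀ k k', k.val = k'.val → HEq (g k) (g' k')) (hh : HEq h h') :
    HEq (Arrow.mk (C.ν φ ψ f g h).hom) (Arrow.mk (C.ν φ' ψ' f' g' h').hom) := by
  subst hA hB hD hZ
  obtain rfl : φ = φ' := funext fun i => Fin.ext (hφ i i rfl)
  obtain rfl : ψ = ψ' := funext fun i => Fin.ext (hψ i i rfl)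
  obtain rfl : f = f' := funext fun j => eq_of_heq (hf j j rfl)
  obtain rfl : g = g' := funext fun j => eq_of_heq (hg j j rfl)
  rw [eq_of_heq hh]

theorem νAt_hom {A B D : Word C.Ob} {p : ℕ} {Z : C.Ob} (φ : Fin A.len → Fin B.len)
    (ψ : Fin B.len → Fin D.len) (ξ : Fin D.len → Fin p) (l : Fin p)
    (f : ∀ j, C.Hom (A.fibre φ j) (B.col j)) (g : ∀ k, C.Hom (B.fibre ψ k) (D.col k))
    (h : C.Hom (D.fibre ξ l) Z) :
    Arrow.mk (C.νAt φ ψ ξ l f g h).hom =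
      Arrow.mk (C.ν (A := A.fibre (ξ ∘ ψ ∘ φ) l) (B := B.fibre (ξ ∘ ψ) l) (D := D.fibre ξ l)
        (fibRestr φ (ξ ∘ ψ) l) (fibRestr ψ ξ l) (C.restrict φ (ξ ∘ ψ) l f)
        (C.restrict ψ ξ l g) h).hom :=
  (eq_eqToHom_comp_comp_iff (C.comp_compAt_restrict φ ψ ξ l f g h)
    (C.comp_comp_restrict φ ψ ξ l f g h)).1 rfl

theorem θAt_hom {A : Word C.Ob} {p : ℕ} {Z : C.Ob} (φ : Fin A.len → Fin p) (j : Fin p)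
    (f : C.Hom (A.fibre φ j) Z) : Arrow.mk (C.θAt φ j f).hom = Arrow.mk (C.θ f).hom :=
  (eq_eqToHom_comp_iff (C.compAt_ones φ j f)).1 rfl

theorem ζAt_hom {A B : Word C.Ob} (φ : Fin A.len → Fin B.len)
    (f : ∀ j, C.Hom (A.fibre φ j) (B.col j)) (j : Fin B.len) :
    Arrow.mk (C.ζAt φ f j).hom = Arrow.mk (C.ζ (f j)).hom :=
  (eq_eqToHom_comp_iff (C.compAt_id_ones φ f j)).1 rfl

theorem θ_hom_heq {A A' : Word C.Ob} {Z Z' : C.Ob} (hA : A = A') (hZ : Z = Z') {f : C.Hom A Z}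
    {f' : C.Hom A' Z'} (hf : HEq f f') :
    HEq (Arrow.mk (C.θ f).hom) (Arrow.mk (C.θ f').hom) := by
  subst hA hZ
  rw [eq_of_heq hf]

theorem ζ_hom_heq {A A' : Word C.Ob} {Z Z' : C.Ob} (hA : A = A') (hZ : Z = Z') {f : C.Hom A Z}
    {f' : C.Hom A' Z'} (hf : HEq f f') :
    HEq (Arrow.mk (C.ζ f).hom) (Arrow.mk (C.ζ f').hom) := by
  subst hA hZ
  rw [eq_of_heq hf]

/-- Associativity isomorphisms over an element `l` depend only on the fibres over `l`. -/
theorem νAt_hom_heq {A A' B B' D D' : Word C.Ob} {p p' : ℕ} {Z Z' : C.Ob}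
    {φ : Fin A.len → Fin B.len} {φ' : Fin A'.len → Fin B'.len} {ψ : Fin B.len → Fin D.len}
    {ψ' : Fin B'.len → Fin D'.len} {ξ : Fin D.len → Fin p} {ξ' : Fin D'.len → Fin p'}
    {eA : Fin A'.len → Fin A.len} {eB : Fin B'.len → Fin B.len} {eD : Fin D'.len → Fin D.len}
    {eP : Fin p' → Fin p} (hA : ∀ i, A'.col i = A.col (eA i)) (hB : ∀ i, B'.col i = B.col (eB i))
    (hD : ∀ i, D'.col i = D.col (eD i)) (hφ : IsRestriction eA eB φ' φ)
    (hψ : IsRestriction eB eD ψ' ψ) (hξ : IsRestriction eD eP ξ' ξ)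
    {l' : Fin p'} {l : Fin p} (hl : eP l' = l) (hZ : Z' = Z)
    {f' : ∀ j, C.Hom (A'.fibre φ' j) (B'.col j)} {f : ∀ j, C.Hom (A.fibre φ j) (B.col j)}
    (hf : ∀ j, HEq (f' j) (f (eB j)))
    {g' : ∀ k, C.Hom (B'.fibre ψ' k) (D'.col k)} {g : ∀ k, C.Hom (B.fibre ψ k) (D.col k)}
    (hg : ∀ k, HEq (g' k) (g (eD k)))
    {h' : C.Hom (D'.fibre ξ' l') Z'} {h : C.Hom (D.fibre ξ l) Z} (hh : HEq h' h) :
    HEq (Arrow.mk (C.νAt φ' ψ' ξ' l' f' g' h').hom) (Arrow.mk (C.νAt φ ψ ξ l f g h).hom) := by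
  subst hl hZ
  rw [νAt_hom, νAt_hom]
  have hψξ := hψ.comp hξ
  refine C.ν_hom_heq ((hφ.comp hψξ).fibre_eq hA l') (hψξ.fibre_eq hB l') (hξ.fibre_eq hD l') rfl
    (fun i i' hi => hφ.fibRestr_val hψξ hi) (fun i i' hi => hψ.fibRestr_val hξ hi)
    (fun j j' hj => ?_) (fun k k' hk => ?_) hh
  · refine (C.castObj_heq _ _).trans (HEq.trans ?_ (C.castObj_heq _ _).symm)
    exact (hf _).trans (congr_arg_heq f ((hψξ.enum_fib l').2 j j' hj))
  · refine (C.castObj_heq _ _).trans (HEq.trans ?_ (C.castObj_heq _ _).symm)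
    exact (hg _).trans (congr_arg_heq g ((hξ.enum_fib l').2 k k' hk))

end WeakMulticatData

/-! ### Naturality and coherence fibre by fibre -/

namespace MulticatData

variable (C : MulticatData.{w, v, u}) {A B : Word C.Ob} {p : ℕ} {Z : C.Ob}
  (φ : Fin A.len → Fin B.len) (ψ : Fin B.len → Fin p) (k : Fin p)

/-- The subfamily of a family of morphisms indexed by the fibre `ψ⁻¹ k`. -/
def restrictMap {f f' : ∀ j, C.Hom (A.fibre φ j) (B.col j)} (α : f ⟶ f') :
    C.restrict φ ψ k f ⟶ C.restrict φ ψ k f' :=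
  fun j => (C.castFunctor (A.fibre_fibRestr φ ψ k j).symm rfl).map (α (fibEmb ψ k j))

theorem restrict_apply_heq (f : ∀ j, C.Hom (A.fibre φ j) (B.col j)) (j : Fin (fibCard ψ k)) :
    HEq (C.restrict φ ψ k f j) (f (fibEmb ψ k j)) :=
  C.castObj_heq _ _

theorem restrictMap_apply_heq {f f' : ∀ j, C.Hom (A.fibre φ j) (B.col j)} (α : f ⟶ f')
    (j : Fin (fibCard ψ k)) :
    HEq (Arrow.mk (C.restrictMap φ ψ k α j)) (Arrow.mk (α (fibEmb ψ k j))) :=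
  C.castFunctor_map_heq _ _ _

variable {φ ψ k}

/-- `compAt` is the composition functor of the restricted map. -/
theorem compAt_map_eq_comp_map {χ : Fin (fibCard (ψ ∘ φ) k) → Fin (fibCard ψ k)}
    (hχ : fibRestr φ ψ k = χ) {x y : ∀ j, C.Hom (A.fibre φ j) (B.col j)}
    {x' y' : ∀ j, C.Hom ((A.fibre (ψ ∘ φ) k).fibre χ j) ((B.fibre ψ k).col j)}
    {α : x ⟶ y} {α' : x' ⟶ y'}
    (hα : ∀ j, HEq (Arrow.mk (α (fibEmb ψ k j))) (Arrow.mk (α' j)))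
    {s t s' t' : C.Hom (B.fibre ψ k) Z} {β : s ⟶ t} {β' : s' ⟶ t'}
    (hβ : Arrow.mk β = Arrow.mk β') :
    Arrow.mk ((C.compAt φ ψ k).map (α ×ₘ β)) =
      Arrow.mk ((C.comp (A := A.fibre (ψ ∘ φ) k) (B := B.fibre ψ k) χ).map (α' ×ₘ β')) := by
  subst hχ
  refine eq_of_heq (C.μ_map_heq rfl rfl rfl ?_ ?_ (heq_of_eq hβ))
  · intro i i' hi
    rw [Fin.ext hi]
  · intro j j' hj
    obtain rfl := Fin.ext hj
    exact hα j

theorem compAt_obj_eq_comp_obj {χ : Fin (fibCard (ψ ∘ φ) k) → Fin (fibCard ψ k)}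
    (hχ : fibRestr φ ψ k = χ) {x : ∀ j, C.Hom (A.fibre φ j) (B.col j)}
    {x' : ∀ j, C.Hom ((A.fibre (ψ ∘ φ) k).fibre χ j) ((B.fibre ψ k).col j)}
    (hx : ∀ j, HEq (x (fibEmb ψ k j)) (x' j)) {s s' : C.Hom (B.fibre ψ k) Z} (hs : s = s') :
    (C.compAt φ ψ k).obj (x, s) =
      (C.comp (A := A.fibre (ψ ∘ φ) k) (B := B.fibre ψ k) χ).obj (x', s') := by
  subst hχ hs
  refine eq_of_heq (C.μ_obj_heq rfl rfl ?_ ?_ HEq.rfl)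
  · intro i i' hi
    rw [Fin.ext hi]
  · intro j j' hj
    obtain rfl := Fin.ext hj
    exact hx j

section

variable {D : Word C.Ob} (φ : Fin A.len → Fin B.len) (ψ : Fin B.len → Fin D.len)
  (ξ : Fin D.len → Fin p) (l : Fin p) (k : Fin (fibCard ξ l))

/-- Composition over `k ∈ ξ⁻¹ l` does not change when all data are first restricted to the fibres
over `l`. -/
theorem compAt_restrict_obj_heq (f : ∀ j, C.Hom (A.fibre φ j) (B.col j))
    {s' : C.Hom ((B.fibre (ξ ∘ ψ) l).fibre (fibRestr ψ ξ l) k) Z}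
    {s : C.Hom (B.fibre ψ (fibEmb ξ l k)) Z} (hs : HEq s' s) :
    HEq ((C.compAt (A := A.fibre (ξ ∘ ψ ∘ φ) l) (B := B.fibre (ξ ∘ ψ) l)
        (fibRestr φ (ξ ∘ ψ) l) (fibRestr ψ ξ l) k).obj (C.restrict φ (ξ ∘ ψ) l f, s'))
      ((C.compAt φ ψ (fibEmb ξ l k)).obj (f, s)) :=
  C.compAt_obj_heq (A' := A.fibre (ξ ∘ ψ ∘ φ) l) (A := A) (B' := B.fibre (ξ ∘ ψ) l) (B := B)
    (fun _ => rfl) (fun _ => rfl)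
    (isRestriction_fibRestr φ (ξ ∘ ψ) l) (isRestriction_fibRestr ψ ξ l) rfl rfl
    (C.restrict_apply_heq φ (ξ ∘ ψ) l f) hs

/-- Composition over `k ∈ ξ⁻¹ l` does not change when all data are first restricted to the fibres
over `l`, on morphisms. -/
theorem compAt_restrict_map_heq {f f' : ∀ j, C.Hom (A.fibre φ j) (B.col j)} (α : f ⟶ f')
    {s' t' : C.Hom ((B.fibre (ξ ∘ ψ) l).fibre (fibRestr ψ ξ l) k) Z} {β' : s' ⟶ t'}
    {s t : C.Hom (B.fibre ψ (fibEmb ξ l k)) Z} {β : s ⟶ t}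
    (hβ : HEq (Arrow.mk β') (Arrow.mk β)) :
    HEq (Arrow.mk ((C.compAt (A := A.fibre (ξ ∘ ψ ∘ φ) l) (B := B.fibre (ξ ∘ ψ) l)
        (fibRestr φ (ξ ∘ ψ) l) (fibRestr ψ ξ l) k).map (C.restrictMap φ (ξ ∘ ψ) l α ×ₘ β')))
      (Arrow.mk ((C.compAt φ ψ (fibEmb ξ l k)).map (α ×ₘ β))) :=
  C.compAt_map_heq (A' := A.fibre (ξ ∘ ψ ∘ φ) l) (A := A) (B' := B.fibre (ξ ∘ ψ) l) (B := B)
    (fun _ => rfl) (fun _ => rfl)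
    (isRestriction_fibRestr φ (ξ ∘ ψ) l) (isRestriction_fibRestr ψ ξ l) rfl rfl
    (C.restrictMap_apply_heq φ (ξ ∘ ψ) l α) hβ

end

end MulticatData

/-- The associativity isomorphism over `l ∈ χ⁻¹ m` does not change when all data are first
restricted to the fibres over `m`. -/
theorem WeakMulticatData.νAt_restrict_hom_heq (C : WeakMulticatData.{w, v, u})
    {A B D E : Word C.Ob} {p : ℕ} {Z : C.Ob} (φ : Fin A.len → Fin B.len)
    (ψ : Fin B.len → Fin D.len) (ξ : Fin D.len → Fin E.len) (χ : Fin E.len → Fin p) (m : Fin p)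
    (l : Fin (fibCard χ m)) (f : ∀ j, C.Hom (A.fibre φ j) (B.col j))
    (g : ∀ k, C.Hom (B.fibre ψ k) (D.col k))
    {h' : C.Hom ((D.fibre (χ ∘ ξ) m).fibre (fibRestr ξ χ m) l) Z}
    {h : C.Hom (D.fibre ξ (fibEmb χ m l)) Z} (hh : HEq h' h) :
    HEq (Arrow.mk (C.νAt (A := A.fibre (χ ∘ ξ ∘ ψ ∘ φ) m) (B := B.fibre (χ ∘ ξ ∘ ψ) m)
        (D := D.fibre (χ ∘ ξ) m) (fibRestr φ (χ ∘ ξ ∘ ψ) m) (fibRestr ψ (χ ∘ ξ) m)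
        (fibRestr ξ χ m) l (C.restrict φ (χ ∘ ξ ∘ ψ) m f) (C.restrict ψ (χ ∘ ξ) m g) h').hom)
      (Arrow.mk (C.νAt φ ψ ξ (fibEmb χ m l) f g h).hom) :=
  C.νAt_hom_heq (A' := A.fibre (χ ∘ ξ ∘ ψ ∘ φ) m) (A := A) (B' := B.fibre (χ ∘ ξ ∘ ψ) m) (B := B)
    (D' := D.fibre (χ ∘ ξ) m) (D := D) (fun _ => rfl) (fun _ => rfl) (fun _ => rfl)
    (isRestriction_fibRestr φ (χ ∘ ξ ∘ ψ) m) (isRestriction_fibRestr ψ (χ ∘ ξ) m)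
    (isRestriction_fibRestr ξ χ m) rfl rfl
    (C.restrict_apply_heq φ (χ ∘ ξ ∘ ψ) m f) (C.restrict_apply_heq ψ (χ ∘ ξ) m g) hh

namespace SymWeakMulticat

variable (C : SymWeakMulticat.{w, v, u}) {A B D E : Word C.Ob} {p : ℕ} {Z : C.Ob}

theorem νAt_naturality (φ : Fin A.len → Fin B.len) (ψ : Fin B.len → Fin D.len)
    (ξ : Fin D.len → Fin p) (l : Fin p) {f f' : ∀ j, C.Hom (A.fibre φ j) (B.col j)}
    {g g' : ∀ k, C.Hom (B.fibre ψ k) (D.col k)} {h h' : C.Hom (D.fibre ξ l) Z}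
    (α : f ⟶ f') (β : g ⟶ g') (γ : h ⟶ h') :
    (C.compAt (ψ ∘ φ) ξ l).map
        ((show (fun k => (C.compAt φ ψ k).obj (f, g k)) ⟶
            (fun k => (C.compAt φ ψ k).obj (f', g' k)) from
          fun k => (C.compAt φ ψ k).map (α ×ₘ β k)) ×ₘ γ) ≫ (C.νAt φ ψ ξ l f' g' h').hom =
      (C.νAt φ ψ ξ l f g h).hom ≫
        (C.compAt φ (ξ ∘ ψ) l).map (α ×ₘ (C.compAt ψ ξ l).map (β ×ₘ γ)) := by
  have key := C.ν_naturality (A := A.fibre (ξ ∘ ψ ∘ φ) l) (B := B.fibre (ξ ∘ ψ) l)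
    (D := D.fibre ξ l) (fibRestr φ (ξ ∘ ψ) l) (fibRestr ψ ξ l) (C.restrictMap φ (ξ ∘ ψ) l α)
    (C.restrictMap ψ ξ l β) γ
  refine Arrow.mk_injective _ _ (Eq.trans ?_ ((congrArg Arrow.mk key).trans ?_))
  · refine arrow_comp_congr (C.compAt_map_eq_comp_map (fibRestr_comp φ ψ ξ l).symm ?_ rfl)
      (C.νAt_hom φ ψ ξ l f' g' h')
    intro k
    exact (C.compAt_restrict_map_heq φ ψ ξ l k α (C.restrictMap_apply_heq ψ ξ l β k)).symm
  · refine arrow_comp_congr (C.νAt_hom φ ψ ξ l f g h).symm ?_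
    exact (C.compAt_map_eq_comp_map rfl (fun j => (C.restrictMap_apply_heq φ (ξ ∘ ψ) l α j).symm)
      (C.compAt_map_eq_comp_map rfl (fun j => (C.restrictMap_apply_heq ψ ξ l β j).symm) rfl)).symm

theorem θAt_naturality (φ : Fin A.len → Fin p) (j : Fin p) {f f' : C.Hom (A.fibre φ j) Z}
    (α : f ⟶ f') :
    (C.compAt id φ j).map (𝟙 (C.ones A) ×ₘ α) ≫ (C.θAt φ j f').hom = (C.θAt φ j f).hom ≫ α := by
  refine Arrow.mk_injective _ _ (Eq.trans ?_ ((congrArg Arrow.mk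
    (C.θ_naturality (A := A.fibre φ j) α)).trans ?_))
  · refine arrow_comp_congr (C.compAt_map_eq_comp_map (fibRestr_id φ j) ?_ rfl)
      (C.θAt_hom φ j f')
    intro i
    refine C.arrow_id_heq ?_ rfl ?_
    · exact (A.single_eq_fibre_id _).symm.trans ((A.fibre φ j).single_eq_fibre_id i)
    · exact (C.ones_heq _).trans (C.ones_heq (A := A.fibre φ j) i).symm
  · exact arrow_comp_congr (C.θAt_hom φ j f).symm rfl

theorem ζAt_naturality (φ : Fin A.len → Fin B.len) {f f' : ∀ j, C.Hom (A.fibre φ j) (B.col j)}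
    (α : f ⟶ f') (j : Fin B.len) :
    (C.compAt φ id j).map (α ×ₘ 𝟙 (C.ones B j)) ≫ (C.ζAt φ f' j).hom =
      (C.ζAt φ f j).hom ≫ α j := by
  refine Arrow.mk_injective _ _ (Eq.trans ?_ ((congrArg Arrow.mk
    (C.ζ_naturality (A := A.fibre φ j) (α j))).trans ?_))
  · refine arrow_comp_congr ?_ (C.ζAt_hom φ f' j)
    -- the fibre of the identity over `j` is a one-letter word, so both maps are constant
    have h1 := B.single_eq_fibre_id j
    refine eq_of_heq (C.μ_map_heq rfl h1.symm rfl ?_ ?_ (C.arrow_id_heq h1.symm rfl (C.ones_heq j)))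
    · intro i i' _
      have h2 : fibCard id j = 1 := congrArg Word.len h1.symm
      have h3 := (fibRestr φ id j i).2
      change (fibRestr φ id j i).val = 0
      omega
    · intro i i' _
      have h2 : fibEmb id j i = j := apply_fibEmb id j i
      exact congr_arg_heq (fun j => Arrow.mk (α j)) h2
  · exact arrow_comp_congr (C.ζAt_hom φ f j).symm rfl

/-- The pentagon over `m` is the pentagon for the maps restricted to the fibres over `m`: the two
equations have the same factors, up to the presentation of the words. -/
theorem νAt_pentagon (φ : Fin A.len → Fin B.len) (ψ : Fin B.len → Fin D.len)
    (ξ : Fin D.len → Fin E.len) (χ : Fin E.len → Fin p) (m : Fin p)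
    (f : ∀ j, C.Hom (A.fibre φ j) (B.col j)) (g : ∀ k, C.Hom (B.fibre ψ k) (D.col k))
    (h : ∀ l, C.Hom (D.fibre ξ l) (E.col l)) (i : C.Hom (E.fibre χ m) Z) :
    (C.compAt (ξ ∘ ψ ∘ φ) χ m).map
        ((show (fun l => (C.compAt (ψ ∘ φ) ξ l).obj
              (fun k => (C.compAt φ ψ k).obj (f, g k), h l)) ⟶
            (fun l => (C.compAt φ (ξ ∘ ψ) l).obj (f, (C.compAt ψ ξ l).obj (g, h l))) from
          fun l => (C.νAt φ ψ ξ l f g (h l)).hom) ×ₘ 𝟙 i) ≫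
      (C.νAt φ (ξ ∘ ψ) χ m f (fun l => (C.compAt ψ ξ l).obj (g, h l)) i).hom ≫
      (C.compAt φ (χ ∘ ξ ∘ ψ) m).map (𝟙 f ×ₘ (C.νAt ψ ξ χ m g h i).hom) =
    (C.νAt (ψ ∘ φ) ξ χ m (fun k => (C.compAt φ ψ k).obj (f, g k)) h i).hom ≫
      (C.νAt φ ψ (χ ∘ ξ) m f g ((C.compAt ξ χ m).obj (h, i))).hom := by
  have hf := C.restrict_apply_heq φ (χ ∘ ξ ∘ ψ) m f
  have hg := C.restrict_apply_heq ψ (χ ∘ ξ) m g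
  have hh := C.restrict_apply_heq ξ χ m h
  -- restriction commutes with composition, so the maps `ξψ` and `ψφ` in the factors below restrict
  -- to the composites of the restricted maps
  have hψξ : fibRestr (ξ ∘ ψ) χ m = fibRestr ξ χ m ∘ fibRestr ψ (χ ∘ ξ) m :=
    (fibRestr_comp ψ ξ χ m).symm
  have hψφ : fibRestr (ψ ∘ φ) (χ ∘ ξ) m = fibRestr ψ (χ ∘ ξ) m ∘ fibRestr φ (χ ∘ ξ ∘ ψ) m :=
    (fibRestr_comp φ ψ (χ ∘ ξ) m).symm
  have key := C.pentagon (A := A.fibre (χ ∘ ξ ∘ ψ ∘ φ) m) (B := B.fibre (χ ∘ ξ ∘ ψ) m)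
    (D := D.fibre (χ ∘ ξ) m) (E := E.fibre χ m) (fibRestr φ (χ ∘ ξ ∘ ψ) m) (fibRestr ψ (χ ∘ ξ) m)
    (fibRestr ξ χ m) (C.restrict φ (χ ∘ ξ ∘ ψ) m f) (C.restrict ψ (χ ∘ ξ) m g)
    (C.restrict ξ χ m h) i
  refine Arrow.mk_injective _ _ (Eq.trans ?_ ((congrArg Arrow.mk key).trans ?_))
  · refine arrow_comp_congr ?_ (arrow_comp_congr ?_ ?_)
    · refine C.compAt_map_eq_comp_map ?_ ?_ rfl
      · exact ((congrArg (· ∘ _) hψξ).symm.trans (fibRestr_comp φ (ξ ∘ ψ) χ m)).symm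
      · exact fun l => (C.νAt_restrict_hom_heq φ ψ ξ χ m l f g (hh l)).symm
    · refine (C.νAt_hom φ (ξ ∘ ψ) χ m f _ i).trans (eq_of_heq ?_)
      refine C.ν_hom_heq rfl rfl rfl rfl ?_ ?_ ?_ ?_ HEq.rfl
      · intro i i' hi; rw [Fin.ext hi]
      · intro i i' hi; rw [Fin.ext hi, hψξ]
      · intro j j' hj; rw [Fin.ext hj]
      · intro k k' hk
        obtain rfl := Fin.ext hk
        exact (C.restrict_apply_heq (ξ ∘ ψ) χ m _ k).trans
          (C.compAt_restrict_obj_heq ψ ξ χ m k g (hh k)).symm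
    · exact C.compAt_map_eq_comp_map rfl (fun j => C.arrow_id_heq
        ((A.fibre_fibRestr φ (χ ∘ ξ ∘ ψ) m j).symm) rfl (hf j).symm) (C.νAt_hom ψ ξ χ m g h i)
  · refine (arrow_comp_congr ?_ ?_).symm
    · refine (C.νAt_hom (ψ ∘ φ) ξ χ m _ h i).trans (eq_of_heq ?_)
      refine C.ν_hom_heq rfl rfl rfl rfl ?_ ?_ ?_ ?_ HEq.rfl
      · intro i i' hi; rw [Fin.ext hi, hψφ]
      · intro i i' hi; rw [Fin.ext hi]
      · intro k k' hk
        obtain rfl := Fin.ext hk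
        exact (C.restrict_apply_heq (ψ ∘ φ) (χ ∘ ξ) m _ k).trans
          (C.compAt_restrict_obj_heq φ ψ (χ ∘ ξ) m k f (hg k)).symm
      · intro j j' hj; rw [Fin.ext hj]
    · refine (C.νAt_hom φ ψ (χ ∘ ξ) m f g _).trans (eq_of_heq ?_)
      refine C.ν_hom_heq rfl rfl rfl rfl ?_ ?_ ?_ ?_ (heq_of_eq ?_)
      · intro i i' hi; obtain rfl := Fin.ext hi; rfl
      · intro i i' hi; obtain rfl := Fin.ext hi; rfl
      · intro j j' hj; obtain rfl := Fin.ext hj; rfl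
      · intro j j' hj; obtain rfl := Fin.ext hj; rfl
      · exact C.compAt_obj_eq_comp_obj rfl (fun j => (hh j).symm) rfl

/-- The triangle over `k` is the triangle for the map restricted to the fibres over `k`. -/
theorem νAt_triangle (φ : Fin A.len → Fin B.len) (ψ : Fin B.len → Fin p) (k : Fin p)
    (f : ∀ j, C.Hom (A.fibre φ j) (B.col j)) (g : C.Hom (B.fibre ψ k) Z) :
    (C.νAt φ id ψ k f (C.ones B) g).hom ≫ (C.compAt φ ψ k).map (𝟙 f ×ₘ (C.θAt ψ k g).hom) =
      (C.compAt φ ψ k).map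
        ((show (fun j => (C.compAt φ id j).obj (f, C.ones B j)) ⟶ f from
          fun j => (C.ζAt φ f j).hom) ×ₘ 𝟙 g) := by
  have hf := C.restrict_apply_heq φ ψ k f
  have key := C.triangle (A := A.fibre (ψ ∘ φ) k) (B := B.fibre ψ k) (fibRestr φ ψ k)
    (C.restrict φ ψ k f) g
  refine Arrow.mk_injective _ _ (Eq.trans ?_ ((congrArg Arrow.mk key).trans ?_))
  · refine arrow_comp_congr ?_ ?_
    · refine (C.νAt_hom φ id ψ k f _ g).trans (eq_of_heq ?_)
      refine C.ν_hom_heq rfl rfl rfl rfl ?_ ?_ ?_ ?_ HEq.rfl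
      · intro i i' hi; obtain rfl := Fin.ext hi; rfl
      · intro i i' hi; obtain rfl := Fin.ext hi; rw [fibRestr_id]
      · intro j j' hj; obtain rfl := Fin.ext hj; rfl
      · intro j j' hj
        obtain rfl := Fin.ext hj
        exact (C.restrict_apply_heq id ψ k _ j).trans
          ((C.ones_heq _).trans (C.ones_heq (A := B.fibre ψ k) j).symm)
    · exact C.compAt_map_eq_comp_map rfl (fun j => C.arrow_id_heq
        ((A.fibre_fibRestr φ ψ k j).symm) rfl (hf j).symm) (C.θAt_hom ψ k g)
  · refine (C.compAt_map_eq_comp_map rfl (fun j => ?_) rfl).symm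
    exact (heq_of_eq (C.ζAt_hom φ f (fibEmb ψ k j))).trans
      ((C.ζ_hom_heq (A.fibre_fibRestr φ ψ k j).symm rfl (hf j).symm).trans
        (heq_of_eq
          (C.ζAt_hom (A := A.fibre (ψ ∘ φ) k) (B := B.fibre ψ k) (fibRestr φ ψ k) _ j).symm))

end SymWeakMulticat

/-! ### The bicategory -/

namespace SymWeakMulticat

variable (C : SymWeakMulticat.{w, v, u})


theorem envelope_a_naturality {A B D E : Word C.Ob} {F F' : C.EnvHom A B} {G G' : C.EnvHom B D}
    {H H' : C.EnvHom D E} (α : F ⟶ F') (β : G ⟶ G') (γ : H ⟶ H') :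
    C.envComp.map (C.envComp.map (α ×ₘ β) ×ₘ γ) ≫ (C.envelope.a F' G' H').hom =
      (C.envelope.a F G H).hom ≫ C.envComp.map (α ×ₘ C.envComp.map (β ×ₘ γ)) := by
  obtain ⟨φ, f⟩ := F
  obtain ⟨ψ, g⟩ := G
  obtain ⟨ξ, h⟩ := H
  obtain ⟨α⟩ := α
  obtain ⟨β⟩ := β
  obtain ⟨γ⟩ := γ
  exact congrArg Sigma.SigmaHom.mk (funext fun l => C.νAt_naturality φ ψ ξ l α β (γ l))

theorem envelope_l_naturality {A B : Word C.Ob} {F F' : C.EnvHom A B} (α : F ⟶ F') :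
    C.envComp.map (𝟙 (C.envOne A) ×ₘ α) ≫ (C.envelope.l F').hom = (C.envelope.l F).hom ≫ α := by
  obtain ⟨φ, f⟩ := F
  obtain ⟨α⟩ := α
  exact congrArg Sigma.SigmaHom.mk (funext fun j => C.θAt_naturality φ j (α j))

theorem envelope_r_naturality {A B : Word C.Ob} {F F' : C.EnvHom A B} (α : F ⟶ F') :
    C.envComp.map (α ×ₘ 𝟙 (C.envOne B)) ≫ (C.envelope.r F').hom = (C.envelope.r F).hom ≫ α := by
  obtain ⟨φ, f⟩ := F
  obtain ⟨α⟩ := α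
  exact congrArg Sigma.SigmaHom.mk (funext fun j => C.ζAt_naturality φ α j)

theorem envelope_pentagon {A B D E K : Word C.Ob} (F : C.EnvHom A B) (G : C.EnvHom B D)
    (H : C.EnvHom D E) (I : C.EnvHom E K) :
    C.envComp.map ((C.envelope.a F G H).hom ×ₘ 𝟙 I) ≫
        (C.envelope.a F (C.envComp.obj (G, H)) I).hom ≫
        C.envComp.map (𝟙 F ×ₘ (C.envelope.a G H I).hom) =
      (C.envelope.a (C.envComp.obj (F, G)) H I).hom ≫
        (C.envelope.a F G (C.envComp.obj (H, I))).hom :=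
  congrArg Sigma.SigmaHom.mk (funext fun m =>
    C.νAt_pentagon F.1 G.1 H.1 I.1 m F.2 G.2 H.2 (I.2 m))

theorem envelope_triangle {A B D : Word C.Ob} (F : C.EnvHom A B) (G : C.EnvHom B D) :
    (C.envelope.a F (C.envOne B) G).hom ≫ C.envComp.map (𝟙 F ×ₘ (C.envelope.l G).hom) =
      C.envComp.map ((C.envelope.r F).hom ×ₘ 𝟙 G) :=
  congrArg Sigma.SigmaHom.mk (funext fun k => C.νAt_triangle F.1 G.1 k F.2 (G.2 k))

theorem envelope_isBicategory : C.envelope.IsBicategory where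
  a_naturality := C.envelope_a_naturality
  l_naturality := C.envelope_l_naturality
  r_naturality := C.envelope_r_naturality
  pentagon := C.envelope_pentagon
  triangle := C.envelope_triangle

end SymWeakMulticat

/-! ### Gluing maps from their restrictions to blocks -/

namespace Word

variable {S : Type u} {I J M K : ℕ} {f : Fin I → Fin K} {g : Fin J → Fin K} {h : Fin M → Fin K}
  {A : Fin I → Word S} {B : Fin J → Word S} {D : Fin M → Word S}

/-- The glued map restricts to the given maps on blocks. -/
theorem isRestriction_glue (φ : ∀ k, Fin (concatFib A f k).len → Fin (concatFib B g k).len)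
    (k : Fin K) : IsRestriction (blkEmb A f k) (blkEmb B g k) (φ k) (glue f g A B φ) where
  strictMono := blkEmb_strictMono A f k
  injective := (blkEmb_strictMono B g k).injective
  comm := glue_blkEmb f g A B φ k
  exists_eq i j hij := by
    have hk : blk A f i = k := by rw [← blk_glue f g A B φ i, hij, blk_blkEmb]
    exact ⟨blkIdx A f k i hk, blkEmb_blkIdx A f k i hk⟩

theorem eq_glue {φ : ∀ k, Fin (concatFib A f k).len → Fin (concatFib B g k).len}
    {χ : Fin (concat A).len → Fin (concat B).len}
    (hχ : ∀ k s, χ (blkEmb A f k s) = blkEmb B g k (φ k s)) : χ = glue f g A B φ := by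
  funext s
  rw [← blkEmb_blkIdx A f (blk A f s) s rfl, hχ, glue_blkEmb]

theorem glue_comp (φ : ∀ k, Fin (concatFib A f k).len → Fin (concatFib B g k).len)
    (ψ : ∀ k, Fin (concatFib B g k).len → Fin (concatFib D h k).len) :
    glue g h B D ψ ∘ glue f g A B φ = glue f h A D (fun k => ψ k ∘ φ k) :=
  eq_glue fun k s => by simp [glue_blkEmb]

theorem glue_id : glue f f A A (fun _ => id) = id :=
  (eq_glue fun _ _ => rfl).symm

/-- A family indexed by the positions of the blocks, evaluated at the position of a block
determined by a position of the concatenation. -/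
theorem apply_blkIdx_heq {β : ∀ k, Fin (concatFib B g k).len → Sort*} (t : ∀ k q, β k q)
    {k : Fin K} {q : Fin (concatFib B g k).len} {s : Fin (concat B).len} (hs : blkEmb B g k q = s) :
    HEq (t (blk B g s) (blkIdx B g (blk B g s) s rfl)) (t k q) := by
  have key : ∀ k' (h : blk B g s = k'),
      HEq (t (blk B g s) (blkIdx B g (blk B g s) s rfl)) (t k' (blkIdx B g k' s h)) := by
    rintro _ rfl
    rfl
  have hk : blk B g s = k := by rw [← hs, blk_blkEmb]
  refine (key k hk).trans (congr_arg_heq (t k) ?_)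
  apply (blkEmb_strictMono B g k).injective
  rw [blkEmb_blkIdx, hs]

end Word

/-! ### Morphisms of the envelope as arrows -/

/-- Every family of morphisms of disjoint unions of categories consists of morphisms of summands. -/
theorem piSigma_hom_ind {K : Type} {T : K → Type} {X : ∀ k, T k → Type v}
    [∀ k t, Category.{w} (X k t)]
    {motive : ∀ F G : ∀ k, Σ t : T k, X k t, (F ⟶ G) → Prop}
    (mk : ∀ (t : ∀ k, T k) (x y : ∀ k, X k (t k)) (α : ∀ k, x k ⟶ y k),
      motive (fun k => ⟨t k, x k⟩) (fun k => ⟨t k, y k⟩) (fun k => Sigma.SigmaHom.mk (α k)))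
    {F G : ∀ k, Σ t : T k, X k t} (η : F ⟶ G) : motive F G η := by
  obtain ⟨t, x, rfl⟩ : ∃ (t : ∀ k, T k) (x : ∀ k, X k (t k)), F = fun k => ⟨t k, x k⟩ :=
    ⟨fun k => (F k).1, fun k => (F k).2, rfl⟩
  obtain ⟨t', y, rfl⟩ : ∃ (t : ∀ k, T k) (x : ∀ k, X k (t k)), G = fun k => ⟨t k, x k⟩ :=
    ⟨fun k => (G k).1, fun k => (G k).2, rfl⟩
  obtain rfl : t = t' := funext fun k => sigma_fst (η k)
  have hη : η = fun k => Sigma.SigmaHom.mk (sigmaSnd (η k)) := by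
    funext k
    have : ∀ β : (⟨t k, x k⟩ : Σ t, X k t) ⟶ ⟨t k, y k⟩, β = Sigma.SigmaHom.mk (sigmaSnd β) := by
      rintro ⟨β⟩
      rfl
    exact this (η k)
  rw [hη]
  exact mk t x y _

namespace SymWeakMulticat

variable (C : SymWeakMulticat.{w, v, u})

/-- A morphism of the envelope, given by a family of morphisms in the summand indexed by `φ`. -/
def envArrow {A B : Word C.Ob} (φ : Fin A.len → Fin B.len)
    {x y : ∀ j, C.Hom (A.fibre φ j) (B.col j)} (α : x ⟶ y) : Arrow (C.EnvHom A B) :=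
  Arrow.mk (X := ⟨φ, x⟩) (Y := ⟨φ, y⟩) (Sigma.SigmaHom.mk α)

theorem envArrow_ext {A B : Word C.Ob} {φ φ' : Fin A.len → Fin B.len} (hφ : φ = φ')
    {x y : ∀ j, C.Hom (A.fibre φ j) (B.col j)} {x' y' : ∀ j, C.Hom (A.fibre φ' j) (B.col j)}
    {α : x ⟶ y} {α' : x' ⟶ y'} (h : ∀ j, HEq (Arrow.mk (α j)) (Arrow.mk (α' j))) :
    C.envArrow φ α = C.envArrow φ' α' := by
  subst hφ
  have h' := C.arrow_pi_congr (α := α) (α' := α') fun j => eq_of_heq (h j)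
  obtain rfl : x = x' := congrArg Comma.left h'
  obtain rfl : y = y' := congrArg Comma.right h'
  rw [Arrow.mk_injective _ _ h']

theorem envComp_map_arrow {A B D : Word C.Ob} {φ : Fin A.len → Fin B.len}
    {ψ : Fin B.len → Fin D.len} {x y : ∀ j, C.Hom (A.fibre φ j) (B.col j)}
    {s t : ∀ k, C.Hom (B.fibre ψ k) (D.col k)} {α : x ⟶ y} {β : s ⟶ t}
    {F F' : C.EnvHom A B} {G G' : C.EnvHom B D} {η : F ⟶ F'} {θ : G ⟶ G'}
    (hη : Arrow.mk η = C.envArrow φ α) (hθ : Arrow.mk θ = C.envArrow ψ β) :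
    Arrow.mk (C.envComp.map (η ×ₘ θ)) =
      C.envArrow (ψ ∘ φ) (x := fun k => (C.compAt φ ψ k).obj (x, s k))
        (y := fun k => (C.compAt φ ψ k).obj (y, t k))
        (fun k => (C.compAt φ ψ k).map (α ×ₘ β k)) := by
  obtain rfl : F = ⟨φ, x⟩ := congrArg Comma.left hη
  obtain rfl : F' = ⟨φ, y⟩ := congrArg Comma.right hη
  obtain rfl : G = ⟨ψ, s⟩ := congrArg Comma.left hθ
  obtain rfl : G' = ⟨ψ, t⟩ := congrArg Comma.right hθ
  obtain rfl : η = Sigma.SigmaHom.mk α := Arrow.mk_injective _ _ hη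
  obtain rfl : θ = Sigma.SigmaHom.mk β := Arrow.mk_injective _ _ hθ
  rfl

theorem envelope_a_arrow {A B D E : Word C.Ob} {φ : Fin A.len → Fin B.len}
    {ψ : Fin B.len → Fin D.len} {ξ : Fin D.len → Fin E.len}
    {x : ∀ j, C.Hom (A.fibre φ j) (B.col j)} {y : ∀ k, C.Hom (B.fibre ψ k) (D.col k)}
    {z : ∀ l, C.Hom (D.fibre ξ l) (E.col l)} {F : C.EnvHom A B} {G : C.EnvHom B D}
    {H : C.EnvHom D E} (hF : F = ⟨φ, x⟩) (hG : G = ⟨ψ, y⟩) (hH : H = ⟨ξ, z⟩) :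
    Arrow.mk (C.envelope.a F G H).hom =
      C.envArrow (ξ ∘ ψ ∘ φ)
        (x := fun l => (C.compAt (ψ ∘ φ) ξ l).obj (fun k => (C.compAt φ ψ k).obj (x, y k), z l))
        (y := fun l => (C.compAt φ (ξ ∘ ψ) l).obj (x, (C.compAt ψ ξ l).obj (y, z l)))
        (fun l => (C.νAt φ ψ ξ l x y (z l)).hom) := by
  subst hF hG hH
  rfl

theorem envelope_l_arrow {A B : Word C.Ob} {φ : Fin A.len → Fin B.len}
    {x : ∀ j, C.Hom (A.fibre φ j) (B.col j)} {F : C.EnvHom A B} (hF : F = ⟨φ, x⟩) :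
    Arrow.mk (C.envelope.l F).hom =
      C.envArrow φ (x := fun j => (C.compAt id φ j).obj (C.ones A, x j)) (y := x)
        (fun j => (C.θAt φ j (x j)).hom) := by
  subst hF
  rfl

theorem envelope_r_arrow {A B : Word C.Ob} {φ : Fin A.len → Fin B.len}
    {x : ∀ j, C.Hom (A.fibre φ j) (B.col j)} {F : C.EnvHom A B} (hF : F = ⟨φ, x⟩) :
    Arrow.mk (C.envelope.r F).hom =
      C.envArrow φ (x := fun j => (C.compAt φ id j).obj (x, C.ones B j)) (y := x)
        (fun j => (C.ζAt φ x j).hom) := by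
  subst hF
  rfl

theorem envHom_ext {A B : Word C.Ob} {φ φ' : Fin A.len → Fin B.len} (hφ : φ = φ')
    {x : ∀ j, C.Hom (A.fibre φ j) (B.col j)} {x' : ∀ j, C.Hom (A.fibre φ' j) (B.col j)}
    (h : ∀ j, HEq (x j) (x' j)) : (⟨φ, x⟩ : C.EnvHom A B) = ⟨φ', x'⟩ := by
  subst hφ
  rw [funext fun j => eq_of_heq (h j)]

/-! ### The tensor product of the envelope -/

section

variable {I J M N L : ℕ} {f : Fin I → Fin L} {g : Fin J → Fin L} {h : Fin M → Fin L}
  {e : Fin N → Fin L} {A : Fin I → Word C.Ob} {B : Fin J → Word C.Ob} {D : Fin M → Word C.Ob}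
  {E : Fin N → Word C.Ob}

/-- The family of objects obtained by gluing families over the blocks: the object at a position `q`
is the given one at the position of `q` in its block, transported to the words of the glued map. -/
def glueObj (φ : ∀ k, Fin (Word.concatFib A f k).len → Fin (Word.concatFib B g k).len)
    (x : ∀ k q, C.Hom ((Word.concatFib A f k).fibre (φ k) q) ((Word.concatFib B g k).col q))
    (q : Fin (Word.concat B).len) :
    C.Hom ((Word.concat A).fibre (Word.glue f g A B φ) q) ((Word.concat B).col q) :=
  (C.castFunctor (Word.fibre_glue_blkIdx f g A B φ q) (Word.col_blkIdx g B q)).obj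
    (x (Word.blk B g q) (Word.blkIdx B g (Word.blk B g q) q rfl))

/-- The family of morphisms obtained by gluing families over the blocks. -/
def glueMap {φ : ∀ k, Fin (Word.concatFib A f k).len → Fin (Word.concatFib B g k).len}
    {x y : ∀ k q, C.Hom ((Word.concatFib A f k).fibre (φ k) q) ((Word.concatFib B g k).col q)}
    (α : ∀ k, x k ⟶ y k) : C.glueObj φ x ⟶ C.glueObj φ y := fun q =>
  (C.castFunctor (Word.fibre_glue_blkIdx f g A B φ q) (Word.col_blkIdx g B q)).map
    (α (Word.blk B g q) (Word.blkIdx B g (Word.blk B g q) q rfl))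

theorem glueObj_heq (φ : ∀ k, Fin (Word.concatFib A f k).len → Fin (Word.concatFib B g k).len)
    (x : ∀ k q, C.Hom ((Word.concatFib A f k).fibre (φ k) q) ((Word.concatFib B g k).col q))
    {k : Fin L} {q : Fin (Word.concatFib B g k).len} {s : Fin (Word.concat B).len}
    (hs : Word.blkEmb B g k q = s) :
    HEq (C.glueObj φ x s) (x k q) :=
  (C.castFunctor_obj_heq _ _ _).trans (Word.apply_blkIdx_heq x hs)

theorem glueMap_heq {φ : ∀ k, Fin (Word.concatFib A f k).len → Fin (Word.concatFib B g k).len}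
    {x y : ∀ k q, C.Hom ((Word.concatFib A f k).fibre (φ k) q) ((Word.concatFib B g k).col q)}
    (α : ∀ k, x k ⟶ y k)
    {k : Fin L} {q : Fin (Word.concatFib B g k).len} {s : Fin (Word.concat B).len}
    (hs : Word.blkEmb B g k q = s) :
    HEq (Arrow.mk (C.glueMap α s)) (Arrow.mk (α k q)) :=
  (C.castFunctor_map_heq _ _ _).trans (Word.apply_blkIdx_heq (fun k q => Arrow.mk (α k q)) hs)

theorem envTensor_obj (φ : ∀ k, Fin (Word.concatFib A f k).len → Fin (Word.concatFib B g k).len)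
    (x : ∀ k q, C.Hom ((Word.concatFib A f k).fibre (φ k) q) ((Word.concatFib B g k).col q)) :
    (C.envTensor f g A B).obj (fun k => ⟨φ k, x k⟩) = ⟨Word.glue f g A B φ, C.glueObj φ x⟩ :=
  rfl

theorem envTensor_map_mk (φ : ∀ k, Fin (Word.concatFib A f k).len → Fin (Word.concatFib B g k).len)
    {x y : ∀ k q, C.Hom ((Word.concatFib A f k).fibre (φ k) q) ((Word.concatFib B g k).col q)}
    (α : ∀ k, x k ⟶ y k) :
    Arrow.mk ((C.envTensor f g A B).map (X := fun k => ⟨φ k, x k⟩) (Y := fun k => ⟨φ k, y k⟩)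
        (fun k => Sigma.SigmaHom.mk (α k))) =
      C.envArrow (Word.glue f g A B φ) (C.glueMap α) :=
  rfl

theorem envTensor_map_arrow
    {φ : ∀ k, Fin (Word.concatFib A f k).len → Fin (Word.concatFib B g k).len}
    {x y : ∀ k q, C.Hom ((Word.concatFib A f k).fibre (φ k) q) ((Word.concatFib B g k).col q)}
    {α : ∀ k, x k ⟶ y k} {F G : ∀ k, C.EnvHom (Word.concatFib A f k) (Word.concatFib B g k)}
    {η : F ⟶ G} (hη : ∀ k, Arrow.mk (η k) = C.envArrow (φ k) (α k)) :
    Arrow.mk ((C.envTensor f g A B).map η) =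
      C.envArrow (Word.glue f g A B φ) (C.glueMap α) := by
  obtain rfl : F = fun k => ⟨φ k, x k⟩ := funext fun k => congrArg Comma.left (hη k)
  obtain rfl : G = fun k => ⟨φ k, y k⟩ := funext fun k => congrArg Comma.right (hη k)
  obtain rfl : η = (fun k => Sigma.SigmaHom.mk (α k) :
      ∀ k, (⟨φ k, x k⟩ : C.EnvHom _ _) ⟶ ⟨φ k, y k⟩) :=
    funext fun k => Arrow.mk_injective _ _ (hη k)
  exact C.envTensor_map_mk φ α

/-- Compositions may be computed before or after gluing. -/
theorem compAt_glueMap_heq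
    {φ : ∀ k, Fin (Word.concatFib A f k).len → Fin (Word.concatFib B g k).len}
    {ψ : ∀ k, Fin (Word.concatFib B g k).len → Fin (Word.concatFib D h k).len}
    {x y : ∀ k q, C.Hom ((Word.concatFib A f k).fibre (φ k) q) ((Word.concatFib B g k).col q)}
    {s t : ∀ k q, C.Hom ((Word.concatFib B g k).fibre (ψ k) q) ((Word.concatFib D h k).col q)}
    (α : ∀ k, x k ⟶ y k) (β : ∀ k, s k ⟶ t k)
    {k : Fin L} {q : Fin (Word.concatFib D h k).len} {r : Fin (Word.concat D).len}
    (hr : Word.blkEmb D h k q = r) :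
    HEq (Arrow.mk ((C.compAt (φ k) (ψ k) q).map (α k ×ₘ β k q)))
      (Arrow.mk ((C.compAt (Word.glue f g A B φ) (Word.glue g h B D ψ) r).map
        (C.glueMap α ×ₘ C.glueMap β r))) :=
  C.compAt_map_heq (A' := Word.concatFib A f k) (A := Word.concat A) (B' := Word.concatFib B g k)
    (B := Word.concat B) (Word.concatFib_col A f k) (Word.concatFib_col B g k)
    (Word.isRestriction_glue φ k) (Word.isRestriction_glue ψ k) hr
    (by rw [Word.concatFib_col, hr]) (fun _ => (C.glueMap_heq α rfl).symm)
    (C.glueMap_heq β hr).symm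

/-- Associativity isomorphisms may be computed before or after gluing. -/
theorem νAt_glue_hom_heq
    (φ : ∀ k, Fin (Word.concatFib A f k).len → Fin (Word.concatFib B g k).len)
    (ψ : ∀ k, Fin (Word.concatFib B g k).len → Fin (Word.concatFib D h k).len)
    (ξ : ∀ k, Fin (Word.concatFib D h k).len → Fin (Word.concatFib E e k).len)
    (x : ∀ k q, C.Hom ((Word.concatFib A f k).fibre (φ k) q) ((Word.concatFib B g k).col q))
    (y : ∀ k q, C.Hom ((Word.concatFib B g k).fibre (ψ k) q) ((Word.concatFib D h k).col q))
    (z : ∀ k q, C.Hom ((Word.concatFib D h k).fibre (ξ k) q) ((Word.concatFib E e k).col q))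
    {k : Fin L} {q : Fin (Word.concatFib E e k).len} {r : Fin (Word.concat E).len}
    (hr : Word.blkEmb E e k q = r) :
    HEq (Arrow.mk (C.νAt (φ k) (ψ k) (ξ k) q (x k) (y k) (z k q)).hom)
      (Arrow.mk (C.νAt (Word.glue f g A B φ) (Word.glue g h B D ψ) (Word.glue h e D E ξ) r
        (C.glueObj φ x) (C.glueObj ψ y) (C.glueObj ξ z r)).hom) :=
  C.νAt_hom_heq (A' := Word.concatFib A f k) (A := Word.concat A) (B' := Word.concatFib B g k)
    (B := Word.concat B) (D' := Word.concatFib D h k) (D := Word.concat D)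
    (Word.concatFib_col A f k) (Word.concatFib_col B g k) (Word.concatFib_col D h k)
    (Word.isRestriction_glue φ k) (Word.isRestriction_glue ψ k) (Word.isRestriction_glue ξ k) hr
    (by rw [Word.concatFib_col, hr]) (fun _ => (C.glueObj_heq φ x rfl).symm)
    (fun _ => (C.glueObj_heq ψ y rfl).symm) (C.glueObj_heq ξ z hr).symm

theorem envTensor_comp_map {F F' : ∀ l, C.EnvHom (Word.concatFib A f l) (Word.concatFib B g l)}
    {G G' : ∀ l, C.EnvHom (Word.concatFib B g l) (Word.concatFib D h l)}
    (η : F ⟶ F') (θ : G ⟶ G') :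
    Arrow.mk (C.envComp.map ((C.envTensor f g A B).map η ×ₘ (C.envTensor g h B D).map θ)) =
      Arrow.mk ((C.envTensor f h A D).map (X := fun l => C.envComp.obj (F l, G l))
        (Y := fun l => C.envComp.obj (F' l, G' l)) (fun l => C.envComp.map (η l ×ₘ θ l))) := by
  induction η using piSigma_hom_ind with | mk φ x y α => ?_
  induction θ using piSigma_hom_ind with | mk ψ s t β => ?_
  refine (C.envComp_map_arrow (C.envTensor_map_mk φ α) (C.envTensor_map_mk ψ β)).trans
    (Eq.trans ?_ (C.envTensor_map_arrow fun l =>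
      C.envComp_map_arrow (φ := φ l) (ψ := ψ l) (α := α l) (β := β l) rfl rfl).symm)
  refine C.envArrow_ext (Word.glue_comp φ ψ) fun q => HEq.symm ?_
  have hq := Word.blkEmb_blkIdx D h _ q rfl
  exact (C.glueMap_heq (φ := fun k => ψ k ∘ φ k) _ hq).trans (C.compAt_glueMap_heq α β hq)

theorem envTensor_comp :
    (C.envTensor f g A B).prod (C.envTensor g h B D) ⋙ C.envComp =
      Functor.pi' (fun l => (Pi.eval _ l).prod (Pi.eval _ l) ⋙ C.envComp) ⋙
        C.envTensor f h A D :=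
  Arrow.functor_ext fun _ _ p => C.envTensor_comp_map p.1 p.2

theorem envTensor_one :
    (C.envTensor f f A A).obj (fun l => C.envOne (Word.concatFib A f l)) =
      C.envOne (Word.concat A) := by
  refine C.envHom_ext Word.glue_id fun q => ?_
  refine (C.castFunctor_obj_heq _ _ _).trans
    ((C.ones_heq _).trans (HEq.trans ?_ (C.ones_heq _).symm))
  exact congr_arg_heq C.one (Word.col_blkIdx f A q)

theorem envTensor_a
    (F : ∀ l, C.EnvHom (Word.concatFib A f l) (Word.concatFib B g l))
    (G : ∀ l, C.EnvHom (Word.concatFib B g l) (Word.concatFib D h l))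
    (H : ∀ l, C.EnvHom (Word.concatFib D h l) (Word.concatFib E e l)) :
    Arrow.mk (C.envelope.a ((C.envTensor f g A B).obj F) ((C.envTensor g h B D).obj G)
        ((C.envTensor h e D E).obj H)).hom =
      Arrow.mk ((C.envTensor f e A E).map
        (X := fun l => C.envComp.obj (C.envComp.obj (F l, G l), H l))
        (Y := fun l => C.envComp.obj (F l, C.envComp.obj (G l, H l)))
        (fun l => (C.envelope.a (F l) (G l) (H l)).hom)) := by
  refine (C.envelope_a_arrow (C.envTensor_obj (fun l => (F l).1) fun l => (F l).2)
    (C.envTensor_obj (fun l => (G l).1) fun l => (G l).2)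
    (C.envTensor_obj (fun l => (H l).1) fun l => (H l).2)).trans
    (Eq.trans ?_ (C.envTensor_map_arrow fun l => C.envelope_a_arrow (φ := (F l).1)
      (ψ := (G l).1) (ξ := (H l).1) (x := (F l).2) (y := (G l).2) (z := (H l).2) rfl rfl rfl).symm)
  refine C.envArrow_ext ?_ fun q => HEq.symm ?_
  · rw [Word.glue_comp, Word.glue_comp]
  have hq := Word.blkEmb_blkIdx E e _ q rfl
  exact (C.glueMap_heq (φ := fun l => (H l).1 ∘ (G l).1 ∘ (F l).1) _ hq).trans
    (C.νAt_glue_hom_heq (fun l => (F l).1) (fun l => (G l).1) (fun l => (H l).1)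
      (fun l => (F l).2) (fun l => (G l).2) (fun l => (H l).2) hq)

theorem envTensor_l (F : ∀ l, C.EnvHom (Word.concatFib A f l) (Word.concatFib B g l)) :
    Arrow.mk (C.envelope.l ((C.envTensor f g A B).obj F)).hom =
      Arrow.mk ((C.envTensor f g A B).map
        (X := fun l => C.envComp.obj (C.envOne (Word.concatFib A f l), F l)) (Y := F)
        (fun l => (C.envelope.l (F l)).hom)) := by
  refine (C.envelope_l_arrow (C.envTensor_obj (fun l => (F l).1) fun l => (F l).2)).trans
    (Eq.trans ?_ (C.envTensor_map_arrow fun l =>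
      C.envelope_l_arrow (φ := (F l).1) (x := (F l).2) rfl).symm)
  refine C.envArrow_ext rfl fun q => HEq.symm ?_
  have hq := Word.blkEmb_blkIdx B g _ q rfl
  refine (C.glueMap_heq (φ := fun l => (F l).1) _ hq).trans ?_
  rw [C.θAt_hom, C.θAt_hom]
  exact C.θ_hom_heq (Word.fibre_glue_blkIdx f g A B (fun l => (F l).1) q) (Word.col_blkIdx g B q)
    (C.glueObj_heq (fun l => (F l).1) (fun l => (F l).2) hq).symm

theorem envTensor_r (F : ∀ l, C.EnvHom (Word.concatFib A f l) (Word.concatFib B g l)) :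
    Arrow.mk (C.envelope.r ((C.envTensor f g A B).obj F)).hom =
      Arrow.mk ((C.envTensor f g A B).map
        (X := fun l => C.envComp.obj (F l, C.envOne (Word.concatFib B g l))) (Y := F)
        (fun l => (C.envelope.r (F l)).hom)) := by
  refine (C.envelope_r_arrow (C.envTensor_obj (fun l => (F l).1) fun l => (F l).2)).trans
    (Eq.trans ?_ (C.envTensor_map_arrow fun l =>
      C.envelope_r_arrow (φ := (F l).1) (x := (F l).2) rfl).symm)
  refine C.envArrow_ext rfl fun q => HEq.symm ?_
  have hq := Word.blkEmb_blkIdx B g _ q rfl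
  refine (C.glueMap_heq (φ := fun l => (F l).1) _ hq).trans ?_
  rw [C.ζAt_hom, C.ζAt_hom]
  exact C.ζ_hom_heq (Word.fibre_glue_blkIdx f g A B (fun l => (F l).1) q) (Word.col_blkIdx g B q)
    (C.glueObj_heq (fun l => (F l).1) (fun l => (F l).2) hq).symm

end

end SymWeakMulticat

/-! ### Iterated blocks -/

namespace Word

variable {S : Type u} {I J K L : ℕ}

theorem range_blkEmb (A : Fin I → Word S) (f : Fin I → Fin K) (k : Fin K) :
    Set.range (blkEmb A f k) = {s | blk A f s = k} := by
  ext s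
  constructor
  · rintro ⟨t, rfl⟩
    exact blk_blkEmb A f k t
  · exact fun h => ⟨blkIdx A f k s h, blkEmb_blkIdx A f k s h⟩

/-- The element of `h⁻¹ l` under a position of the block over `l`, as an element of the source of
`h`. -/
theorem blk_blkEmb_comp (A : Fin I → Word S) (f : Fin I → Fin K) (h : Fin K → Fin L) (l : Fin L)
    (t : Fin (concatFib A (h ∘ f) l).len) :
    blk A f (blkEmb A (h ∘ f) l t) =
      fibEmb h l (blk (fun i => A (fibEmb (h ∘ f) l i)) (fibRestr f h l) t) := by
  rw [blk, blk, fibEmb_fibRestr, blkEmb, pr_inj]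

/-- A block over `k` is a block of the block over `h k`. -/
theorem blkEmb_blkEmb (A : Fin I → Word S) (f : Fin I → Fin K) (h : Fin K → Fin L) (l : Fin L)
    (k : Fin (fibCard h l))
    (t : Fin (concatFib (fun i => A (fibEmb (h ∘ f) l i)) (fibRestr f h l) k).len)
    (s : Fin (concatFib A f (fibEmb h l k)).len) (hts : t.val = s.val) :
    blkEmb A (h ∘ f) l (blkEmb (fun i => A (fibEmb (h ∘ f) l i)) (fibRestr f h l) k t) =
      blkEmb A f (fibEmb h l k) s := by
  -- both sides enumerate increasingly the positions lying over `k`, as an element of `K`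
  have hmono := (blkEmb_strictMono A (h ∘ f) l).comp
    (blkEmb_strictMono (fun i => A (fibEmb (h ∘ f) l i)) (fibRestr f h l) k)
  refine (enum_unique hmono (blkEmb_strictMono A f (fibEmb h l k)) ?_).2 t s hts
  rw [range_blkEmb]
  ext r
  constructor
  · rintro ⟨t, rfl⟩
    exact (blk_blkEmb_comp A f h l _).trans (congrArg (fibEmb h l)
      (blk_blkEmb (fun i => A (fibEmb (h ∘ f) l i)) (fibRestr f h l) k t))
  · intro hr
    have hl : blk A (h ∘ f) r = l := (congrArg h hr).trans (apply_fibEmb h l k)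
    obtain ⟨t, rfl⟩ : ∃ t, blkEmb A (h ∘ f) l t = r :=
      ⟨blkIdx A (h ∘ f) l r hl, blkEmb_blkIdx A (h ∘ f) l r hl⟩
    have ht := (fibEmb h l).injective ((blk_blkEmb_comp A f h l t).symm.trans hr)
    exact ⟨blkIdx (fun i => A (fibEmb (h ∘ f) l i)) (fibRestr f h l) k t ht,
      congrArg (blkEmb A (h ∘ f) l)
        (blkEmb_blkIdx (fun i => A (fibEmb (h ∘ f) l i)) (fibRestr f h l) k t ht)⟩

theorem exists_blkEmb_fibEmb (B : Fin J → Word S) (g : Fin J → Fin K) (h : Fin K → Fin L)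
    (q : Fin (concat B).len) :
    ∃ (l : Fin L) (k : Fin (fibCard h l)) (r : Fin (concatFib B g (fibEmb h l k)).len),
      blkEmb B g (fibEmb h l k) r = q :=
  ⟨h (blk B g q), fibIdx h _ (blk B g q) rfl,
    blkIdx B g _ q (fibEmb_fibIdx h _ (blk B g q) rfl).symm, blkEmb_blkIdx _ _ _ _ _⟩

/-- Gluing over `K` is gluing first over the fibres of `h : K → L` and then over `L`. -/
theorem glue_glue {f : Fin I → Fin K} {g : Fin J → Fin K} {h : Fin K → Fin L}
    {A : Fin I → Word S} {B : Fin J → Word S}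
    {φ : ∀ k, Fin (concatFib A f k).len → Fin (concatFib B g k).len}
    {φ' : ∀ l k,
      Fin (concatFib (fun i => A (fibEmb (h ∘ f) l i)) (fibRestr f h l) k).len →
      Fin (concatFib (fun j => B (fibEmb (h ∘ g) l j)) (fibRestr g h l) k).len}
    (hφ : ∀ l k i i', i.val = i'.val → (φ' l k i).val = (φ (fibEmb h l k) i').val) :
    glue (h ∘ f) (h ∘ g) A B (fun l => glue (fibRestr f h l) (fibRestr g h l)
        (fun i => A (fibEmb (h ∘ f) l i)) (fun j => B (fibEmb (h ∘ g) l j)) (φ' l)) =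
      glue f g A B φ := by
  funext s
  obtain ⟨l, k, r, rfl⟩ := exists_blkEmb_fibEmb A f h s
  let r' := Fin.cast (congrArg Word.len (concatFib_fibRestr A f h l k)) r
  rw [glue_blkEmb, ← blkEmb_blkEmb A f h l k r' r rfl, glue_blkEmb,
    glue_blkEmb]
  exact blkEmb_blkEmb B g h l k (φ' l k r') (φ (fibEmb h l k) r) (hφ l k r' r rfl)

/-- Over a one-element set there is just one block. -/
theorem blkEmb_const_val (A : Fin I → Word S) (l : Fin 1)
    (s : Fin (concatFib A (fun _ => (0 : Fin 1)) l).len) :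
    (blkEmb A (fun _ => (0 : Fin 1)) l s).val = s.val := by
  obtain ⟨h1, h2⟩ := enum_unique (e' := (id : Fin (concat A).len → _))
    (blkEmb_strictMono A (fun _ => (0 : Fin 1)) l) strictMono_id (by
      rw [range_blkEmb, Set.range_id]
      exact Set.eq_univ_of_forall fun _ => Subsingleton.elim _ _)
  exact congrArg Fin.val (h2 s (Fin.cast h1 s) rfl)

end Word

/-! ### Strictness of the tensor product -/

namespace SymWeakMulticat

variable (C : SymWeakMulticat.{w, v, u})

/-- Identifications of words change neither the values of the indexing map nor the morphisms of the
family. -/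
theorem exists_castFunctor_map_arrow {A A' B B' : Word C.Ob} (hA : A = A') (hB : B = B')
    (φ : Fin A.len → Fin B.len) {x y : ∀ j, C.Hom (A.fibre φ j) (B.col j)} (α : x ⟶ y) :
    ∃ (φ' : Fin A'.len → Fin B'.len) (x' y' : ∀ j, C.Hom (A'.fibre φ' j) (B'.col j))
      (α' : x' ⟶ y'),
      Arrow.mk ((C.envelope.castFunctor hA hB).map (X := (⟨φ, x⟩ : C.EnvHom A B)) (Y := ⟨φ, y⟩)
          (Sigma.SigmaHom.mk α)) = C.envArrow φ' α' ∧
        (∀ i i', i.val = i'.val → (φ' i).val = (φ i').val) ∧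
        ∀ j j', j.val = j'.val → HEq (Arrow.mk (α' j)) (Arrow.mk (α j')) := by
  subst hA hB
  refine ⟨φ, x, y, α, rfl, fun i i' hi => ?_, fun j j' hj => ?_⟩
  · rw [Fin.ext hi]
  · rw [Fin.ext hj]

theorem envTensor_terminal_map {I J : ℕ} (A : Fin I → Word C.Ob) (B : Fin J → Word C.Ob)
    {F G : C.EnvHom (Word.concat A) (Word.concat B)} (η : F ⟶ G) :
    Arrow.mk ((C.envTensor (fun _ => 0) (fun _ => 0) A B).map
        (X := fun l : Fin 1 => (C.envelope.castFunctor (Word.concatFib_const A l)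
          (Word.concatFib_const B l)).obj F)
        (Y := fun l : Fin 1 => (C.envelope.castFunctor (Word.concatFib_const A l)
          (Word.concatFib_const B l)).obj G)
        (fun l : Fin 1 => (C.envelope.castFunctor (Word.concatFib_const A l)
          (Word.concatFib_const B l)).map η)) = Arrow.mk η := by
  obtain ⟨φ, x⟩ := F
  obtain ⟨α⟩ := η
  rename_i y
  choose φ' x' y' α' h₁ h₂ h₃ using fun l => C.exists_castFunctor_map_arrow
    (Word.concatFib_const A l) (Word.concatFib_const B l) φ α
  refine (C.envTensor_map_arrow h₁).trans (C.envArrow_ext (Eq.symm ?_) fun q => ?_)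
  · refine Word.eq_glue fun l s => Fin.ext ?_
    rw [Word.blkEmb_const_val]
    exact (h₂ l s _ (Word.blkEmb_const_val A l s).symm).symm
  · have hq := Word.blkEmb_blkIdx B (fun _ => (0 : Fin 1)) 0 q rfl
    refine (C.glueMap_heq _ hq).trans (h₃ 0 _ q ?_)
    rw [← Word.blkEmb_const_val, hq]

section

variable {I J K L : ℕ} {f : Fin I → Fin K} {g : Fin J → Fin K} {h : Fin K → Fin L}
  {A : Fin I → Word C.Ob} {B : Fin J → Word C.Ob}

/-- Tensor products over the fibres of `h : K → L` followed by a tensor product over `L`, on a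
family `ρ` of morphisms which differs from the family `α` only in the presentation of the words. -/
theorem envTensor_envTensor_map_arrow
    {φ : ∀ k, Fin (Word.concatFib A f k).len → Fin (Word.concatFib B g k).len}
    {x y : ∀ k q, C.Hom ((Word.concatFib A f k).fibre (φ k) q) ((Word.concatFib B g k).col q)}
    {α : ∀ k, x k ⟶ y k}
    {F G : ∀ l k, C.EnvHom
      (Word.concatFib (fun i => A (fibEmb (h ∘ f) l i)) (fibRestr f h l) k)
      (Word.concatFib (fun j => B (fibEmb (h ∘ g) l j)) (fibRestr g h l) k)}
    (ρ : ∀ l, F l ⟶ G l)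
    (hρ : ∀ l k, ∃ φ' x' y', ∃ α' : x' ⟶ y',
      Arrow.mk (ρ l k) = C.envArrow φ' α' ∧
        (∀ i i', i.val = i'.val → (φ' i).val = (φ (fibEmb h l k) i').val) ∧
        ∀ j j', j.val = j'.val → HEq (Arrow.mk (α' j)) (Arrow.mk (α (fibEmb h l k) j'))) :
    Arrow.mk ((C.envTensor (h ∘ f) (h ∘ g) A B).map
      (X := fun l => (C.envTensor (fibRestr f h l) (fibRestr g h l)
        (fun i => A (fibEmb (h ∘ f) l i)) (fun j => B (fibEmb (h ∘ g) l j))).obj (F l))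
      (Y := fun l => (C.envTensor (fibRestr f h l) (fibRestr g h l)
        (fun i => A (fibEmb (h ∘ f) l i)) (fun j => B (fibEmb (h ∘ g) l j))).obj (G l))
      (fun l => (C.envTensor (fibRestr f h l) (fibRestr g h l)
        (fun i => A (fibEmb (h ∘ f) l i)) (fun j => B (fibEmb (h ∘ g) l j))).map (ρ l))) =
      C.envArrow (Word.glue f g A B φ) (C.glueMap α) := by
  choose φ' x' y' α' h₁ h₂ h₃ using hρ
  have h₄ := fun l => C.envTensor_map_arrow (h₁ l)
  have h₅ := C.envTensor_map_arrow (f := h ∘ f) (g := h ∘ g) h₄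
  refine h₅.trans (C.envArrow_ext (Word.glue_glue h₂) fun q => ?_)
  obtain ⟨l, k, r, hr⟩ := Word.exists_blkEmb_fibEmb B g h q
  let r' := Fin.cast (congrArg Word.len (Word.concatFib_fibRestr B g h l k)) r
  have hr' := (Word.blkEmb_blkEmb B g h l k r' r rfl).trans hr
  exact (C.glueMap_heq (fun l => C.glueMap (α' l)) hr').trans
    ((C.glueMap_heq (α' l) rfl).trans ((h₃ l k r' r rfl).trans (C.glueMap_heq α hr).symm))

/-- The statement on functors, for functors `R` in the place of the identifications of words. -/
theorem envTensor_envTensor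
    (R : ∀ l k, C.EnvHom (Word.concatFib A f (fibEmb h l k)) (Word.concatFib B g (fibEmb h l k)) ⥤
      C.EnvHom (Word.concatFib (fun i => A (fibEmb (h ∘ f) l i)) (fibRestr f h l) k)
        (Word.concatFib (fun j => B (fibEmb (h ∘ g) l j)) (fibRestr g h l) k))
    (hR : ∀ l k (φ : Fin (Word.concatFib A f (fibEmb h l k)).len →
        Fin (Word.concatFib B g (fibEmb h l k)).len)
      (x y : ∀ q, C.Hom ((Word.concatFib A f (fibEmb h l k)).fibre φ q)
        ((Word.concatFib B g (fibEmb h l k)).col q)) (α : x ⟶ y),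
      ∃ φ' x' y', ∃ α' : x' ⟶ y',
        Arrow.mk ((R l k).map (X := ⟨φ, x⟩) (Y := ⟨φ, y⟩) (Sigma.SigmaHom.mk α)) =
          C.envArrow φ' α' ∧
        (∀ i i', i.val = i'.val → (φ' i).val = (φ i').val) ∧
        ∀ j j', j.val = j'.val → HEq (Arrow.mk (α' j)) (Arrow.mk (α j'))) :
    Functor.pi' (fun l => Functor.pi' (fun k => Pi.eval _ (fibEmb h l k) ⋙ R l k) ⋙
        C.envTensor (fibRestr f h l) (fibRestr g h l) (fun i => A (fibEmb (h ∘ f) l i))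
          (fun j => B (fibEmb (h ∘ g) l j))) ⋙
      C.envTensor (h ∘ f) (h ∘ g) A B = C.envTensor f g A B := by
  refine Arrow.functor_ext fun F G η => ?_
  induction η using piSigma_hom_ind with | mk φ x y α => ?_
  have h₁ := C.envTensor_envTensor_map_arrow (f := f) (g := g) (h := h) (φ := φ) (α := α)
    (F := fun l k => (R l k).obj ⟨φ (fibEmb h l k), x (fibEmb h l k)⟩)
    (G := fun l k => (R l k).obj ⟨φ (fibEmb h l k), y (fibEmb h l k)⟩)
    (fun l k => (R l k).map (Sigma.SigmaHom.mk (α (fibEmb h l k))))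
    (fun l k => hR l k _ _ _ (α (fibEmb h l k)))
  exact h₁.trans (C.envTensor_map_mk φ α).symm

end

/-! ### The axioms of a biprop -/

theorem envelope_tensor_terminal {I J : ℕ} (A : Fin I → Word C.Ob) (B : Fin J → Word C.Ob) :
    Functor.pi' (fun l : Fin 1 =>
        C.envelope.castFunctor (Word.concatFib_const A l) (Word.concatFib_const B l)) ⋙
      C.envelope.tensor (fun _ => 0) (fun _ => 0) A B =
        𝟭 (C.envelope.Hom (Word.concat A) (Word.concat B)) :=
  Arrow.functor_ext fun _ _ η => C.envTensor_terminal_map A B η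

theorem envelope_tensor_tensor {I J K L : ℕ} (f : Fin I → Fin K) (g : Fin J → Fin K)
    (h : Fin K → Fin L) (A : Fin I → Word C.Ob) (B : Fin J → Word C.Ob) :
    Functor.pi' (fun l => Functor.pi' (fun k => Pi.eval _ (fibEmb h l k) ⋙
          C.envelope.castFunctor (Word.concatFib_fibRestr A f h l k)
            (Word.concatFib_fibRestr B g h l k)) ⋙
        C.envelope.tensor (fibRestr f h l) (fibRestr g h l) (fun i => A (fibEmb (h ∘ f) l i))
          (fun j => B (fibEmb (h ∘ g) l j))) ⋙
      C.envelope.tensor (h ∘ f) (h ∘ g) A B = C.envelope.tensor f g A B :=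
  C.envTensor_envTensor
    (fun l k => C.envelope.castFunctor (Word.concatFib_fibRestr A f h l k)
      (Word.concatFib_fibRestr B g h l k))
    fun l k φ _ _ α => C.exists_castFunctor_map_arrow (Word.concatFib_fibRestr A f h l k)
      (Word.concatFib_fibRestr B g h l k) φ α

theorem envelope_tensorComp : C.envelope.TensorComp :=
  fun _ _ _ _ _ _ => C.envTensor_comp

theorem envelope_tensorOne : C.envelope.TensorOne :=
  fun _ _ => C.envTensor_one

end SymWeakMulticat
end BipropEnvelope

theorem mainTheorem1 (C : BipropEnvelope.SymWeakMulticat.{w, v, u}) :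
    C.envelope.IsBiprop where
  toIsBicategory := C.envelope_isBicategory
  tensor_comp := C.envelope_tensorComp
  tensor_a _ _ _ _ _ _ _ _ F G H :=
    (BipropEnvelope.eq_eqToHom_comp_comp_iff _ _).2 (C.envTensor_a F G H)
  tensor_terminal := C.envelope_tensor_terminal
  tensor_one := C.envelope_tensorOne
  tensor_l _ _ _ _ F := (BipropEnvelope.eq_eqToHom_comp_iff _).2 (C.envTensor_l F)
  tensor_r _ _ _ _ F := (BipropEnvelope.eq_eqToHom_comp_iff _).2 (C.envTensor_r F)
  tensor_tensor := C.envelope_tensor_tensor
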